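/- All rings are commutative with unity; a ring $A$ is a valuation ring if its ideals are linearly ordered by inclusion (zero divisors are allowed), and $R$ is arithmetical if $R_P$ is a valuation ring for every maximal ideal $P$. A ring $A$ is coherent if each finitely generated ideal of $A$ is finitely presented, and semicoherent if for any two injective $A$-modules $E,F$ the $A$-module $\operatorname{Hom}_A(E,F)$ is isomorphic to a submodule of a flat $A$-module. An $A$-module $E$ is FP-injective if $\operatorname{Ext}^1_A(F,E)=0$ for every finitely presented $A$-module $F$. Write $E_A(M)$ for the injective hull of an $A$-module $M$; $M$ has finite Goldie dimension if $E_A(M)$ is a direct sum of finitely many indecomposable injective modules. Theorem 5. Let $R$ be an arithmetical ring. The following conditions are equivalent: 1. for each maximal ideal $P$ of $R$, the ring $R_P$ is either coherent or not semicoherent; 2. for each multiplicative subset $S$ of $R$ and each injective $R$-module $G$ of finite Goldie dimension, the $S^{-1}R$-module $S^{-1}G$ is injective; 3. for each multiplicative subset $S$ of $R$ and each FP-injective $R$-module $G$ of finite Goldie dimension, the $S^{-1}R$-module $S^{-1}G$ is FP-injective; 4. for each maximal ideal $P$ of $R$, the $Q(R_P)$-module $Q(R_P)\otimes_R E_R(R/P)$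 is FP-injective, where $Q(R_P)$ is the total ring of fractions of $R_P$ (the localization of $R_P$ at its non-zero-divisors). -/

import Mathlib

open CategoryTheory
open scoped TensorProduct

universe u

/-- A module is uniserial if its submodules are linearly ordered by inclusion. -/
def IsUniserialModule (R M : Type u) [CommRing R] [AddCommGroup M] [Module R M] : Prop :=
  ∀ N N' : Submodule R M, N ≤ N' ∨ N' ≤ N

/-- A commutative ring (possibly with zero divisors) is arithmetical if each localization at a
maximal ideal is uniserial as a module over itself. -/
def IsArithmeticalRing (R : Type u) [CommRing R] : Prop :=
  ∀ (P : Ideal R) [P.IsMaximal],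
    IsUniserialModule (Localization.AtPrime P) (Localization.AtPrime P)

/-- A commutative ring is coherent if every finitely generated ideal is finitely presented. -/
def IsCoherentRing (R : Type u) [CommRing R] : Prop :=
  ∀ I : Ideal R, I.FG → Module.FinitePresentation R I

/-- A commutative ring is semicoherent if, for all injective modules `E` and `F`, the module
`Hom(E, F)` is a submodule of a flat module. -/
def IsSemicoherentRing (R : Type u) [CommRing R] : Prop :=
  ∀ (E F : Type u) [AddCommGroup E] [Module R E] [AddCommGroup F] [Module R F],
    Module.Injective R E → Module.Injective R F →
      ∃ (L : Type u) (_ : AddCommGroup L) (_ : Module R L) (j : (E →ₗ[R] F) →ₗ[R] L),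
        Module.Flat R L ∧ Function.Injective j

/-- `E` is FP-injective if `Ext¹(F, E) = 0` for every finitely presented module `F`. -/
def IsFPInjective (R E : Type u) [CommRing R] [AddCommGroup E] [Module R E] : Prop :=
  ∀ (F : Type u) [AddCommGroup F] [Module R F], Module.FinitePresentation R F →
    Subsingleton (Abelian.Ext (ModuleCat.of R F) (ModuleCat.of R E) 1)

/-- `i : M → E` is an injective hull of `M`: `E` is injective, and `i` is an essential
monomorphism, i.e. its image meets every nonzero submodule of `E` nontrivially. -/
structure IsInjectiveHull {R M E : Type u} [CommRing R] [AddCommGroup M] [Module R M]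
    [AddCommGroup E] [Module R E] (i : M →ₗ[R] E) : Prop where
  moduleInjective : Module.Injective R E
  injective : Function.Injective i
  essential : ∀ N : Submodule R E, LinearMap.range i ⊓ N = ⊥ → N = ⊥

/-- A module is indecomposable if it is nonzero and not the direct sum of two nonzero
submodules. -/
def IsIndecomposableModule (R M : Type u) [CommRing R] [AddCommGroup M] [Module R M] : Prop :=
  Nontrivial M ∧ ∀ A B : Submodule R M, IsCompl A B → A = ⊥ ∨ B = ⊥

/-- `M` has Goldie dimension `n` if its injective hull is a direct sum of `n` indecomposable
injective modules. -/
def HasGoldieDimension (R M : Type u) [CommRing R] [AddCommGroup M] [Module R M] (n : ℕ) : Prop :=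
  ∃ (E : Type u) (_ : AddCommGroup E) (_ : Module R E) (i : M →ₗ[R] E), IsInjectiveHull i ∧
    ∃ N : Fin n → Submodule R E, DirectSum.IsInternal N ∧
      ∀ k, Module.Injective R (N k) ∧ IsIndecomposableModule R (N k)

/-- `M` has finite Goldie dimension. -/
def HasFiniteGoldieDimension (R M : Type u) [CommRing R] [AddCommGroup M] [Module R M] : Prop :=
  ∃ n : ℕ, HasGoldieDimension R M n

/-!
Let `A` be a valuation ring, possibly with zero divisors, `Z` its set of zero divisors and `Q` its
total ring of fractions. All four conditions say that every `A = R_P` satisfies one elementary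
condition, `HasDividedAnnihilators`: either `Q = A`, or `(0 : i) = Z (0 : i)` for all `i ≠ 0`. It
fails exactly if `Q ≠ A` and some `(0 : i)` with `i ≠ 0` is a nonzero principal ideal of `Q`.

* If one annihilator `(0 : i)` is a nonzero principal ideal of `Q`, all of them are principal, and
  `(0 : (0 : r)) = r Q`. Injective `Q`-modules are then flat, and `A` is semicoherent because
  `Hom(E, F)` is torsion-free for injective `E`. Conversely, in a flat module the annihilator of
  an element is controlled by annihilators `(0 : a)`, and a homomorphism `E → E / t E → F` shows
  that the annihilators of a semicoherent valuation ring are principal in `Q`. This identifies the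
  elementary condition with "coherent or not semicoherent" (`hasDividedAnnihilators_iff`).
* If `A` satisfies the condition, all localizations of an injective `A`-module `G` are injective
  (`IsLocalizedModule.injective_of_isUniserial`). Homomorphisms from principal ideals to `S⁻¹G`
  extend, by a computation with annihilators in which the condition is needed only if `S⁻¹A = Q`;
  for an ideal which is not principal in `S⁻¹A`, a homomorphism to `S⁻¹G` that vanishes at some
  nonzero element lifts to `G`, so Baer's criterion for `G` applies.
* An injective `R`-module of finite Goldie dimension is a finite product of indecomposable
  injective modules. These are uniform, so that the elements of `R` not acting injectively form a
  proper ideal, and each factor is an injective `R_P`-module for a suitable maximal ideal `P`.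
  Hence the condition implies that localizations are injective
  (`Module.Injective.localizedModule`).
* An FP-injective module is pure in its injective hull, and purity survives localization, so the
  statement on injective modules gives the one on FP-injective modules. Here FP-injectivity is
  used in the form of solvability of finite systems of linear equations (`isFPInjective_iff`).
* If `(0 : i) = a Q` and `Q ≠ A`, let `e` in the injective hull of `R ⧸ P` satisfy `a e = x₀`,
  where `x₀` generates the socle. In `Q ⊗ E` the element `e` is killed by `(0 : i)` but is not
  divisible by `i`, so `Q ⊗ E` is not FP-injective (`IsInjectiveHull.hasDividedAnnihilators`).
-/

/-! ### Valuation rings with zero divisors -/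

section ValuationRing

variable {A : Type u} [CommRing A]

theorem IsUniserialModule.dvd_or_dvd (h : IsUniserialModule A A) (x y : A) : x ∣ y ∨ y ∣ x := by
  rcases h (Ideal.span {y}) (Ideal.span {x}) with h | h
  · exact Or.inl (Ideal.span_singleton_le_span_singleton.1 h)
  · exact Or.inr (Ideal.span_singleton_le_span_singleton.1 h)

theorem notMem_nonZeroDivisors_iff_exists {c : A} :
    c ∉ nonZeroDivisors A ↔ ∃ d, d ≠ 0 ∧ c * d = 0 := by
  rw [mem_nonZeroDivisors_iff_right]
  push Not
  exact ⟨fun ⟨d, h, h'⟩ => ⟨d, h', by rw [mul_comm, h]⟩,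
    fun ⟨d, h, h'⟩ => ⟨d, by rw [mul_comm, h'], h⟩⟩

theorem eq_zero_of_mem_nonZeroDivisors_mul {p x : A} (hp : p ∈ nonZeroDivisors A)
    (h : p * x = 0) : x = 0 :=
  (mem_nonZeroDivisors_iff_left.1 hp) x h

/-- In a valuation ring the annihilator of `x * c` is strictly larger than the annihilator of `x`
whenever `x * c ≠ 0` and `c` is a zero divisor: two nonzero ideals always meet nontrivially. -/
theorem exists_mul_eq_zero_mul_ne_zero (hA : ∀ x y : A, x ∣ y ∨ y ∣ x) {x c : A}
    (hxc : x * c ≠ 0) (hc : c ∉ nonZeroDivisors A) : ∃ w, x * c * w = 0 ∧ x * w ≠ 0 := by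
  obtain ⟨d, hd, hcd⟩ := notMem_nonZeroDivisors_iff_exists.1 hc
  rcases hA x d with ⟨w, rfl⟩ | ⟨e, rfl⟩
  · exact ⟨w, by linear_combination hcd, hd⟩
  · exact absurd (by linear_combination e * hcd) hxc

/-- Either every regular element of `A` is a unit, or `(0 : i) = Z (0 : i)` for every `i ≠ 0`, where
`Z` is the set of zero divisors. For a valuation ring this says that `A` is its own total ring of
fractions `Q`, or a domain, or `Q` is not coherent. -/
def HasDividedAnnihilators (A : Type u) [CommRing A] : Prop :=
  (∀ p ∈ nonZeroDivisors A, IsUnit p) ∨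
    ∀ i a : A, i ≠ 0 → a ≠ 0 → i * a = 0 →
      ∃ a' l, i * a' = 0 ∧ l ∉ nonZeroDivisors A ∧ a = l * a'

end ValuationRing

/-! ### Extending homomorphisms into injective modules -/

/-- An element `z` of an injective module is divisible by `i` as soon as `(0 : i) z = 0`. -/
theorem Module.Injective.exists_smul_eq {R G : Type u} [CommRing R] [AddCommGroup G] [Module R G]
    (hG : Module.Injective R G) {i : R} {z : G} (h : ∀ a, a * i = 0 → a • z = 0) :
    ∃ w : G, i • w = z := by
  have hle : LinearMap.ker (LinearMap.toSpanSingleton R R i) ≤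
      LinearMap.ker (LinearMap.toSpanSingleton R G z) := fun a ha => by
    simpa using h a (by simpa using ha)
  obtain ⟨k, hk⟩ := Module.Injective.extension_property R G _ _
    ((LinearMap.ker (LinearMap.toSpanSingleton R R i)).liftQ
      (LinearMap.toSpanSingleton R R i) le_rfl)
    (by rw [← LinearMap.ker_eq_bot]; exact Submodule.ker_liftQ_eq_bot _ _ _ le_rfl)
    ((LinearMap.ker (LinearMap.toSpanSingleton R R i)).liftQ
      (LinearMap.toSpanSingleton R G z) hle)
  refine ⟨k 1, ?_⟩
  have h1 : k (LinearMap.toSpanSingleton R R i 1) = LinearMap.toSpanSingleton R G z 1 :=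
    LinearMap.congr_fun hk (Submodule.Quotient.mk 1)
  rw [← map_smul]
  simpa using h1

/-! ### Localizations of injective modules over valuation rings -/

section Localization

variable {A G G' : Type u} [CommRing A] [AddCommGroup G] [Module A G] [AddCommGroup G']
  [Module A G']

theorem IsLocalizedModule.smul_cancel (S : Submonoid A) (f : G →ₗ[A] G') [IsLocalizedModule S f]
    {s : A} (hs : s ∈ S) {x y : G'} (h : s • x = s • y) : x = y :=
  IsLocalizedModule.smul_injective f (⟨s, hs⟩ : S) h

theorem IsLocalizedModule.exists_smul_eq (S : Submonoid A) (f : G →ₗ[A] G') [IsLocalizedModule S f]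
    {s : A} (hs : s ∈ S) (x : G') : ∃ y : G', s • y = x :=
  ((Module.End.isUnit_iff _).1 (IsLocalizedModule.map_units f (⟨s, hs⟩ : S))).2 x

theorem IsLocalizedModule.exists_smul_eq_apply (S : Submonoid A) (f : G →ₗ[A] G')
    [IsLocalizedModule S f] (x : G') : ∃ s ∈ S, ∃ z, s • x = f z := by
  obtain ⟨⟨z, s⟩, h⟩ := IsLocalizedModule.surj S f x
  exact ⟨s, s.2, z, h⟩

theorem IsLocalizedModule.exists_smul_eq_zero (S : Submonoid A) (f : G →ₗ[A] G')
    [IsLocalizedModule S f] {z : G} (h : f z = 0) : ∃ s ∈ S, s • z = 0 := by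
  obtain ⟨s, hs⟩ := (IsLocalizedModule.eq_zero_iff S f).1 h
  exact ⟨s, s.2, hs⟩

/-- An element no multiple of which lies in `S` is divisible by every element of `S`. -/
theorem dvd_of_forall_mul_notMem (hA : ∀ x y : A, x ∣ y ∨ y ∣ x) {S : Submonoid A} {l s : A}
    (hl : ∀ b, l * b ∉ S) (hs : s ∈ S) : s ∣ l := by
  rcases hA s l with h | ⟨b, rfl⟩
  · exact h
  · exact absurd hs (hl b)

/-- Let `A` be a valuation ring with `HasDividedAnnihilators`. Then divisibility in a localization
of an injective module is controlled by annihilators, as it is in the injective module itself. -/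
theorem IsLocalizedModule.exists_smul_eq_of_annihilator (hA : ∀ x y : A, x ∣ y ∨ y ∣ x)
    (hQ : HasDividedAnnihilators A) (hG : Module.Injective A G) (S : Submonoid A) (f : G →ₗ[A] G')
    [IsLocalizedModule S f] {i : A} {y : G'} (h : ∀ a, a * i = 0 → a • y = 0) :
    ∃ w, i • w = y := by
  -- It suffices to treat images of elements of `G`.
  suffices H : ∀ z : G, (∀ a, a * i = 0 → a • f z = 0) → ∃ w, i • w = f z by
    obtain ⟨s, hs, z, hz⟩ := exists_smul_eq_apply S f y
    obtain ⟨w, hw⟩ := H z fun a ha => by rw [← hz, smul_comm, h a ha, smul_zero]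
    obtain ⟨w', rfl⟩ := IsLocalizedModule.exists_smul_eq S f hs w
    exact ⟨w', smul_cancel S f hs (by rw [hz, ← hw, smul_comm])⟩
  clear h y
  intro z h
  -- It suffices that `(0 : i)` kills `s z` for some `s ∈ S`.
  have key : ∀ s ∈ S, (∀ a, a * i = 0 → a • s • z = 0) → ∃ w, i • w = f z := by
    intro s hs hz
    obtain ⟨w, hw⟩ := hG.exists_smul_eq hz
    obtain ⟨w', hw'⟩ := IsLocalizedModule.exists_smul_eq S f hs (f w)
    exact ⟨w', smul_cancel S f hs (by rw [smul_comm, hw', ← map_smul, hw, map_smul])⟩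
  have hkill : ∀ a, a * i = 0 → ∃ s ∈ S, s • a • z = 0 := fun a ha =>
    exists_smul_eq_zero S f (by rw [map_smul, h a ha])
  by_cases hi : ∃ b, i * b ∈ S
  · obtain ⟨b, hb⟩ := hi
    obtain ⟨w, hw⟩ := IsLocalizedModule.exists_smul_eq S f hb (f z)
    exact ⟨b • w, by rw [smul_smul, hw]⟩
  push Not at hi
  by_cases hN : ∃ s ∈ S, s * i = 0
  · obtain ⟨s, hs, hsi⟩ := hN
    exact ⟨0, by rw [smul_zero]; exact (smul_cancel S f hs (by rw [h s hsi, smul_zero])).symm⟩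
  push Not at hN
  by_cases hstrict : ∃ s ∈ S, ∃ a, a * i ≠ 0 ∧ a * (s * i) = 0
  · obtain ⟨s, hs, a, hai, hasi⟩ := hstrict
    obtain ⟨s', hs', hz⟩ := hkill (a * s) (by rw [← hasi]; ring)
    refine key (s' * s) (S.mul_mem hs' hs) fun b hb => ?_
    rcases hA a b with ⟨c, rfl⟩ | ⟨c, rfl⟩
    · have : (a * c) • (s' * s) • z = c • s' • (a * s) • z := by
        simp only [smul_smul]; congr 1; ring
      rw [this, hz, smul_zero]
    · exact absurd (by rw [← mul_zero c, ← hb]; ring) hai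
  push Not at hstrict
  have hreg : ∀ s ∈ S, s ∈ nonZeroDivisors A := by
    intro s hs
    by_contra hsz
    obtain ⟨w, hw, hw'⟩ := exists_mul_eq_zero_mul_ne_zero hA (x := i) (c := s)
      (by rw [mul_comm]; exact hN s hs) hsz
    exact hstrict s hs w (by rwa [mul_comm]) (by rw [← hw]; ring)
  refine key 1 S.one_mem fun a ha => ?_
  rw [one_smul]
  -- It suffices to factor `a` through `(0 : i)` with a cofactor divisible by all of `S`.
  have fin : ∀ l a', (∀ b, l * b ∉ S) → a' * i = 0 → a = l * a' → a • z = 0 := by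
    rintro l a' hl ha' rfl
    obtain ⟨s, hs, hz⟩ := hkill a' ha'
    obtain ⟨c, rfl⟩ := dvd_of_forall_mul_notMem hA hl hs
    have : (s * c * a') • z = c • s • a' • z := by simp only [smul_smul]; congr 1; ring
    rw [this, hz, smul_zero]
  have hi0 : i ≠ 0 := fun h0 => hN 1 S.one_mem (by rw [h0, mul_zero])
  by_cases hl : ∃ l ∈ nonZeroDivisors A, ∀ b, l * b ∉ S
  · obtain ⟨l, hlr, hlS⟩ := hl
    rcases hA l a with ⟨a', rfl⟩ | ⟨c, rfl⟩
    · exact fin l a' hlS (eq_zero_of_mem_nonZeroDivisors_mul hlr (by rw [← ha]; ring)) rfl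
    · exact absurd (eq_zero_of_mem_nonZeroDivisors_mul hlr (by linear_combination c * ha)) hi0
  push Not at hl
  by_cases ha0 : a = 0
  · rw [ha0, zero_smul]
  rcases hQ with hunit | hdiv
  · obtain ⟨s, hs, hz⟩ := hkill a ha
    exact (hunit s (hreg s hs)).smul_eq_zero.1 hz
  · obtain ⟨a', l, ha', hlz, rfl⟩ := hdiv i a hi0 ha0 (by rw [mul_comm, ha])
    refine fin l a' (fun b hb => hlz ?_) (by rw [mul_comm, ha']) rfl
    exact (mul_mem_nonZeroDivisors.1 (hreg _ hb)).1

/-- Over a valuation ring with `HasDividedAnnihilators`, every localization of an injective module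
is injective. The proof is by Baer's criterion: a homomorphism from an ideal `J` to the
localization is given on each principal subideal `j A` by an element `y j`. If `J` is not
principal up to `S`, then the `y j` can be corrected to come from the injective module, up to
elements which are killed by slightly smaller ideals; so the homomorphism lifts to the injective
module, where it extends. -/
theorem IsLocalizedModule.injective_of_isUniserial (hA : ∀ x y : A, x ∣ y ∨ y ∣ x)
    (hQ : HasDividedAnnihilators A) (hG : Module.Injective A G) (S : Submonoid A) (f : G →ₗ[A] G')
    [IsLocalizedModule S f] : Module.Injective A G' := by
  rw [← Module.Baer.iff_injective]
  intro J g
  suffices H : ∃ y : G', ∀ x : J, g x = (x : A) • y by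
    obtain ⟨y, hy⟩ := H
    exact ⟨LinearMap.toSpanSingleton A G' y, fun x hx => by simp [hy]⟩
  have hgmul : ∀ (a : A) (x : J) (y : J), (y : A) = a * x → g y = a • g x := fun a x y h => by
    rw [← map_smul]; congr 1; exact Subtype.ext h
  -- the homomorphism is a multiplication on each principal subideal
  have hprin : ∀ j : J, ∃ y : G', (j : A) • y = g j := fun j =>
    exists_smul_eq_of_annihilator hA hQ hG S f fun a ha => by
      rw [← map_smul, show a • j = 0 from Subtype.ext ha, map_zero]
  by_cases hα : ∃ i : J, ∀ j : J, ∃ s ∈ S, (i : A) ∣ s * j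
  · obtain ⟨i, hi⟩ := hα
    obtain ⟨y, hy⟩ := hprin i
    refine ⟨y, fun j => ?_⟩
    obtain ⟨s, hs, c, hc⟩ := hi j
    refine smul_cancel S f hs ?_
    rw [← map_smul, hgmul c i (s • j) (by simp [hc, mul_comm]), ← hy, smul_smul, smul_smul, hc,
      mul_comm]
  push Not at hα
  -- elements of the localization killed by `i ∈ J`, `i ≠ 0` in `S⁻¹A`, come from `G`
  have hlift : ∀ (i : J) (y : G'), (∀ s ∈ S, s * (i : A) ≠ 0) → (i : A) • y = 0 →
      ∃ v, f v = y ∧ ∃ s ∈ S, s • (i : A) • v = 0 := by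
    intro i y hi hy
    obtain ⟨s, hs, z, hz⟩ := exists_smul_eq_apply S f y
    obtain ⟨t, ht, htz⟩ := exists_smul_eq_zero S f (z := (i : A) • z)
      (by rw [map_smul, ← hz, smul_comm, hy, smul_zero])
    obtain ⟨v, hv⟩ := hG.exists_smul_eq (i := t * s) (z := t • z) fun a ha => by
      rcases hA a i with ⟨c, hc⟩ | ⟨c, rfl⟩
      · exact absurd (by rw [hc]; linear_combination c * ha) (hi _ (S.mul_mem ht hs))
      · rw [smul_smul, show (i : A) * c * t = c * (t * i) by ring, mul_smul, mul_smul, htz,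
          smul_zero]
    refine ⟨v, ?_, t * s, S.mul_mem ht hs, ?_⟩
    · refine smul_cancel S f (S.mul_mem ht hs) ?_
      rw [← map_smul, hv, map_smul, ← hz, smul_smul]
    · rw [smul_comm, hv, smul_comm, htz]
  -- normalize `g` so that it vanishes at a nonzero element `i₀`
  obtain ⟨i₀, hi₀⟩ := hα 0
  obtain ⟨y₀, hy₀⟩ := hprin i₀
  have hy : ∀ j : J, ∃ y : G', (j : A) • y = g j - (j : A) • y₀ := fun j => by
    obtain ⟨y, hy⟩ := hprin j
    exact ⟨y - y₀, by rw [smul_sub, hy]⟩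
  choose y hy using hy
  have hnz : ∀ j : J, (j : A) ∣ i₀ → ∀ s ∈ S, s * (j : A) ≠ 0 := by
    rintro j ⟨c, hc⟩ s hs h0
    exact hi₀ s hs ⟨0, by rw [hc]; linear_combination c * h0⟩
  have hv : ∀ j : J, ∃ v : G, (j : A) ∣ i₀ → f v = y j := by
    intro j
    by_cases hj : (j : A) ∣ i₀
    · obtain ⟨c, hc⟩ := id hj
      obtain ⟨v, hv, -⟩ := hlift i₀ (y j) (hnz i₀ dvd_rfl) (by
        rw [hc, mul_comm, mul_smul, hy, smul_sub, ← hgmul c j i₀ (by rw [hc, mul_comm]), smul_smul,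
          mul_comm, ← hc, hy₀, sub_self])
      exact ⟨v, fun _ => hv⟩
    · exact ⟨0, fun h => absurd h hj⟩
  choose v hv using hv
  -- `j` is admissible for `i` if `j ∣ i₀` and `i` is a multiple of `s j` for every `s ∈ S`
  have hadm : ∀ i : J, ∃ j : J, (j : A) ∣ i₀ ∧ ∀ s ∈ S, ¬ (i : A) ∣ s * j := by
    intro i
    rcases hA i i₀ with h | h
    · obtain ⟨j, hj⟩ := hα i
      refine ⟨j, ?_, hj⟩
      rcases hA (j : A) i with h' | h'
      · exact h'.trans h
      · exact absurd (by rwa [one_mul]) (hj 1 S.one_mem)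
    · obtain ⟨j, hj⟩ := hα i₀
      refine ⟨j, ?_, fun s hs h' => hj s hs (h.trans h')⟩
      rcases hA (j : A) i₀ with h' | h'
      · exact h'
      · exact absurd (by rwa [one_mul]) (hj 1 S.one_mem)
  have hwd' : ∀ i j k : J, (j : A) ∣ i₀ → (∀ s ∈ S, ¬ (i : A) ∣ s * j) → (k : A) ∣ i₀ →
      (k : A) ∣ j → (i : A) • v j = (i : A) • v k := by
    intro i j k hj hij hk hkj
    obtain ⟨d, hd⟩ := id hkj
    obtain ⟨z, hz, s, hs, hsz⟩ := hlift j (y k - y j) (hnz j hj) (by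
      have : (j : A) • y k = d • (k : A) • y k := by rw [smul_smul, hd, mul_comm]
      rw [smul_sub, this, hy, hy, smul_sub, smul_smul, ← hgmul d k j (by rw [hd, mul_comm]),
        mul_comm d, ← hd, sub_self])
    obtain ⟨t, ht, htz⟩ := exists_smul_eq_zero S f (z := v k - v j - z)
      (by rw [map_sub, map_sub, hv k hk, hv j hj, hz, sub_self])
    rcases hA (t * s * j) i with ⟨c, hc⟩ | h
    · have h1 : t • v k - t • v j = t • z := by rw [← smul_sub, ← sub_eq_zero, ← smul_sub, htz]
      have h2 : (i : A) • v k - (i : A) • v j = (c * t) • s • (j : A) • z := by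
        have : ∀ x : G, (i : A) • x = (c * s * j) • t • x := fun x => by
          rw [hc, smul_smul]; congr 1; ring
        rw [this, this, ← smul_sub, h1]
        simp only [smul_smul]; congr 1; ring
      rw [hsz, smul_zero, sub_eq_zero] at h2
      exact h2.symm
    · exact absurd h (hij _ (S.mul_mem ht hs))
  have hwd : ∀ i j k : J, ((j : A) ∣ i₀ ∧ ∀ s ∈ S, ¬ (i : A) ∣ s * j) →
      ((k : A) ∣ i₀ ∧ ∀ s ∈ S, ¬ (i : A) ∣ s * k) → (i : A) • v j = (i : A) • v k := by
    intro i j k hj hk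
    rcases hA (j : A) k with h | h
    · exact (hwd' i k j hk.1 hk.2 hj.1 h).symm
    · exact hwd' i j k hj.1 hj.2 hk.1 h
  choose φ hφ using hadm
  have hadm_dvd : ∀ i i' j : J, (i : A) ∣ i' → ((j : A) ∣ i₀ ∧ ∀ s ∈ S, ¬ (i : A) ∣ s * j) →
      ((j : A) ∣ i₀ ∧ ∀ s ∈ S, ¬ (i' : A) ∣ s * j) := fun i i' j h hj =>
    ⟨hj.1, fun s hs h' => hj.2 s hs (h.trans h')⟩
  let h : J →ₗ[A] G :=
    { toFun := fun i => (i : A) • v (φ i)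
      map_add' := fun i i' => by
        -- an element admissible for the larger of the two ideals is admissible for the sum
        obtain ⟨j, h₁, h₂, h₃⟩ : ∃ j : J, ((j : A) ∣ i₀ ∧ ∀ s ∈ S, ¬ (i : A) ∣ s * j) ∧
            ((j : A) ∣ i₀ ∧ ∀ s ∈ S, ¬ (i' : A) ∣ s * j) ∧
            ((j : A) ∣ i₀ ∧ ∀ s ∈ S, ¬ ((i + i' : J) : A) ∣ s * j) := by
          rcases hA (i : A) i' with hd | hd
          · exact ⟨φ i, hφ i, hadm_dvd i i' _ hd (hφ i),
              hadm_dvd i (i + i') _ (dvd_add dvd_rfl hd) (hφ i)⟩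
          · exact ⟨φ i', hadm_dvd i' i _ hd (hφ i'), hφ i',
              hadm_dvd i' (i + i') _ (dvd_add hd dvd_rfl) (hφ i')⟩
        rw [hwd i _ j (hφ i) h₁, hwd i' _ j (hφ i') h₂, hwd _ _ j (hφ _) h₃, Submodule.coe_add,
          add_smul]
      map_smul' := fun a i => by
        rw [hwd (a • i) _ (φ i) (hφ _) (hadm_dvd i (a • i) _ ⟨a, by simp [mul_comm]⟩ (hφ i)),
          RingHom.id_apply, Submodule.coe_smul, smul_eq_mul, mul_smul] }
  obtain ⟨k, hk⟩ := Module.Baer.of_injective hG J h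
  refine ⟨y₀ + f (k 1), fun i => ?_⟩
  have h1 : (i : A) • k 1 = (i : A) • v (φ i) := by
    rw [← map_smul, smul_eq_mul, mul_one]
    exact hk i i.2
  obtain ⟨c, hc⟩ : (φ i : A) ∣ i := by
    rcases hA (φ i : A) i with h | h
    · exact h
    · exact absurd (by rwa [one_mul]) ((hφ i).2 1 S.one_mem)
  have h2 : (i : A) • y (φ i) = c • (φ i : A) • y (φ i) := by rw [smul_smul, hc, mul_comm]
  rw [smul_add, ← map_smul, h1, map_smul, hv _ (hφ i).1, h2, hy, smul_sub,
    ← hgmul c (φ i) i (by rw [hc, mul_comm]), smul_smul, mul_comm c, ← hc]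
  abel

end Localization

/-! ### Injective hulls and indecomposable injective modules -/

section Hull

variable {R : Type u} [CommRing R]

theorem Module.Injective.of_linearEquiv {M N : Type u} [AddCommGroup M] [Module R M]
    [AddCommGroup N] [Module R N] (e : M ≃ₗ[R] N) (h : Module.Injective R M) :
    Module.Injective R N := by
  rw [← Module.Baer.iff_injective] at h ⊢
  exact Module.Baer.of_equiv e h

/-- A direct summand of an injective module is injective. -/
theorem Module.Injective.of_isCompl {I : Type u} [AddCommGroup I] [Module R I]
    (hI : Module.Injective R I) {E C : Submodule R I} (h : IsCompl E C) :
    Module.Injective R E where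
  out X Y _ _ _ _ f hf g := by
    obtain ⟨k, hk⟩ := hI.out f hf (E.subtype ∘ₗ g)
    refine ⟨E.projectionOnto C h ∘ₗ k, fun x => ?_⟩
    rw [LinearMap.comp_apply, hk]
    exact Submodule.projectionOnto_apply_left h (g x)

theorem Module.exists_injective_embedding (M : Type u) [AddCommGroup M] [Module R M] :
    ∃ (I : Type u) (_ : AddCommGroup I) (_ : Module R I) (j : M →ₗ[R] I),
      Module.Injective R I ∧ Function.Injective j := by
  obtain ⟨P⟩ := EnoughInjectives.presentation (ModuleCat.of R M)
  have := P.injective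
  exact ⟨P.J, inferInstance, inferInstance, P.f.hom,
    Module.injective_module_of_injective_object (M := P.J) R,
    (ModuleCat.mono_iff_injective _).1 P.mono⟩

theorem Submodule.exists_maximal_of_forall_mem {M : Type u} [AddCommGroup M] [Module R M]
    (p : Submodule R M → Prop) (X : Submodule R M) (hX : p X)
    (hp : ∀ c : Set (Submodule R M), (∀ E ∈ c, p E) → IsChain (· ≤ ·) c → c.Nonempty →
      p (sSup c)) : ∃ E, X ≤ E ∧ Maximal p E :=
  zorn_le_nonempty₀ {E | p E} (fun c hc hchain E hE =>
    ⟨sSup c, hp c hc hchain ⟨E, hE⟩, fun _ h => le_sSup h⟩) X hX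

/-- Every submodule `X` of an injective module `I` is essential in a direct summand of `I`, which is
then an injective hull of `X`. Such a summand is a maximal essential extension of `X` inside `I`. -/
theorem Module.Injective.exists_isCompl_essential {I : Type u} [AddCommGroup I] [Module R I]
    (hI : Module.Injective R I) (X : Submodule R I) :
    ∃ E C : Submodule R I, IsCompl E C ∧ X ≤ E ∧ ∀ Y ≤ E, X ⊓ Y = ⊥ → Y = ⊥ := by
  obtain ⟨E, hXE, hE⟩ := Submodule.exists_maximal_of_forall_mem
    (fun E : Submodule R I => X ≤ E ∧ ∀ Y ≤ E, X ⊓ Y = ⊥ → Y = ⊥) X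
    ⟨le_rfl, fun Y hY h => by rwa [inf_eq_right.2 hY] at h⟩ (by
      intro c hc hchain hne
      obtain ⟨E₀, hE₀⟩ := hne
      refine ⟨(hc E₀ hE₀).1.trans (le_sSup hE₀), fun Y hY h => ?_⟩
      rw [Submodule.eq_bot_iff]
      intro y hy
      obtain ⟨E, hE, hyE⟩ := (Submodule.mem_sSup_of_directed ⟨E₀, hE₀⟩ hchain.directedOn).1 (hY hy)
      have := (hc E hE).2 (R ∙ y) ((Submodule.span_singleton_le_iff_mem _ _).2 hyE)
        (le_bot_iff.1 (h ▸ inf_le_inf_left X ((Submodule.span_singleton_le_iff_mem _ _).2 hy)))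
      exact Submodule.span_singleton_eq_bot.1 this)
  obtain ⟨C, -, hC⟩ := Submodule.exists_maximal_of_forall_mem
    (fun C : Submodule R I => Disjoint E C) ⊥ disjoint_bot_right (by
      intro c hc hchain hne
      rw [Submodule.disjoint_def]
      intro y hyE hy
      obtain ⟨C, hC, hyC⟩ := (Submodule.mem_sSup_of_directed hne hchain.directedOn).1 hy
      exact Submodule.disjoint_def.1 (hc C hC) y hyE hyC)
  -- extend the inclusion of `E` along the monomorphism `E → I ⧸ C`
  obtain ⟨φ, hφ⟩ := hI.out (C.mkQ ∘ₗ E.subtype) (by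
    rw [← LinearMap.ker_eq_bot, LinearMap.ker_comp, Submodule.ker_mkQ, Submodule.eq_bot_iff]
    exact fun x hx => Subtype.ext (Submodule.disjoint_def.1 hC.1 x x.2 hx)) E.subtype
  have hφE : ∀ e ∈ E, (φ ∘ₗ C.mkQ) e = e := fun e he => hφ ⟨e, he⟩
  have hmax : E = LinearMap.range (φ ∘ₗ C.mkQ) := by
    refine le_antisymm (fun e he => ⟨e, hφE e he⟩) (hE.2 ⟨fun x hx => ⟨x, hφE x (hXE hx)⟩, ?_⟩
      fun e he => ⟨e, hφE e he⟩)
    intro Y hY hXY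
    have hEY : E ⊓ Y = ⊥ := hE.1.2 _ inf_le_left
      (le_bot_iff.1 (hXY ▸ inf_le_inf_left X inf_le_right))
    have hW : Y.comap (φ ∘ₗ C.mkQ) ≤ C := hC.2 (by
      refine Submodule.disjoint_def.2 ?_
      intro e he heY
      rw [Submodule.mem_comap, hφE e he] at heY
      exact (Submodule.eq_bot_iff _).1 hEY e ⟨he, heY⟩) (fun x hx => by
        have : C.mkQ x = 0 := by simpa using hx
        simp [this])
    rw [Submodule.eq_bot_iff]
    intro y hy
    obtain ⟨x, rfl⟩ := hY hy
    have : C.mkQ x = 0 := by simpa using hW hy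
    simp [this]
  refine ⟨E, LinearMap.ker ((φ ∘ₗ C.mkQ).codRestrict E fun x => hmax ▸ ⟨x, rfl⟩),
    LinearMap.isCompl_of_proj fun x => Subtype.ext (hφE x x.2), hXE, hE.1.2⟩

theorem exists_isInjectiveHull (M : Type u) [AddCommGroup M] [Module R M] :
    ∃ (E : Type u) (_ : AddCommGroup E) (_ : Module R E) (i : M →ₗ[R] E), IsInjectiveHull i := by
  obtain ⟨I, _, _, j, hI, hj⟩ := Module.exists_injective_embedding (R := R) M
  obtain ⟨E, C, hEC, hle, hess⟩ := hI.exists_isCompl_essential (LinearMap.range j)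
  refine ⟨E, inferInstance, inferInstance, j.codRestrict E fun x => hle ⟨x, rfl⟩,
    hI.of_isCompl hEC, fun x y h => hj (congrArg Subtype.val h), fun N hN => ?_⟩
  have := hess (N.map E.subtype) (Submodule.map_subtype_le E N) (by
    rw [Submodule.eq_bot_iff]
    rintro _ ⟨⟨x, rfl⟩, ⟨y, hy, hxy⟩⟩
    have hy0 : y = 0 := (Submodule.eq_bot_iff _).1 hN y ⟨⟨x, Subtype.ext hxy.symm⟩, hy⟩
    rw [← hxy, hy0, map_zero])
  exact Submodule.map_injective_of_injective E.injective_subtype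
    (this.trans (Submodule.map_bot _).symm)

/-- Indecomposable injective modules are uniform. -/
theorem IsIndecomposableModule.eq_bot_of_inf_eq_bot {N : Type u} [AddCommGroup N] [Module R N]
    (hN : IsIndecomposableModule R N) (hI : Module.Injective R N) {X Y : Submodule R N}
    (h : X ⊓ Y = ⊥) : X = ⊥ ∨ Y = ⊥ := by
  obtain ⟨E, C, hEC, hle, hess⟩ := hI.exists_isCompl_essential X
  rcases hN.2 E C hEC with rfl | rfl
  · exact Or.inl (le_bot_iff.1 hle)
  · rw [eq_top_of_isCompl_bot hEC] at hess
    exact Or.inr (hess Y le_top h)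

/-- An indecomposable injective module is, for some maximal ideal `P`, a module over the
localization at `P`: the elements which do not act injectively form a proper ideal. -/
theorem IsIndecomposableModule.exists_isMaximal_bijective {N : Type u} [AddCommGroup N] [Module R N]
    (hN : IsIndecomposableModule R N) (hI : Module.Injective R N) :
    ∃ P : Ideal R, P.IsMaximal ∧ ∀ s ∉ P, Function.Bijective fun x : N => s • x := by
  have := hN.1
  have hker : ∀ {r : R} {x : N}, x ∈ LinearMap.ker (LinearMap.lsmul R N r) ↔ r • x = 0 := by simp
  let J : Ideal R :=
    { carrier := {r | LinearMap.ker (LinearMap.lsmul R N r) ≠ ⊥}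
      zero_mem' := by
        obtain ⟨x, hx⟩ := exists_ne (0 : N)
        exact fun h => hx ((Submodule.eq_bot_iff _).1 h x (hker.2 (zero_smul R x)))
      add_mem' := fun {r s} hr hs h => by
        have h0 : LinearMap.ker (LinearMap.lsmul R N r) ⊓
            LinearMap.ker (LinearMap.lsmul R N s) = ⊥ :=
          (Submodule.eq_bot_iff _).2 fun x hx => (Submodule.eq_bot_iff _).1 h x (hker.2 (by
            rw [add_smul, hker.1 hx.1, hker.1 hx.2, add_zero]))
        exact (hN.eq_bot_of_inf_eq_bot hI h0).elim hr hs
      smul_mem' := fun c r hr h => hr ((Submodule.eq_bot_iff _).2 fun x hx =>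
        (Submodule.eq_bot_iff _).1 h x (hker.2 (by rw [smul_assoc, hker.1 hx, smul_zero]))) }
  have hJ : J ≠ ⊤ := fun h => by
    have h1 : (1 : R) ∈ J := h ▸ Submodule.mem_top
    exact h1 ((Submodule.eq_bot_iff _).2 fun x hx => by simpa using hx)
  obtain ⟨P, hP, hJP⟩ := Ideal.exists_le_maximal J hJ
  refine ⟨P, hP, fun s hs => ?_⟩
  have hs' : LinearMap.ker (LinearMap.lsmul R N s) = ⊥ := by
    by_contra h
    exact hs (hJP h)
  have hinj : ∀ x : N, s • x = 0 → x = 0 := fun x hx => (Submodule.eq_bot_iff _).1 hs' x (hker.2 hx)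
  refine ⟨fun x y hxy => sub_eq_zero.1 (hinj _ (by rw [smul_sub]; exact sub_eq_zero.2 hxy)),
    fun y => hI.exists_smul_eq fun a ha => hinj _ ?_⟩
  rw [smul_smul, mul_comm, ha, zero_smul]

end Hull

/-! ### Injectivity over a ring and over its localizations -/

section ChangeOfRings

variable {R B M : Type u} [CommRing R] [CommRing B] [Algebra R B] [AddCommGroup M] [Module R M]
  [Module B M] [IsScalarTower R B M]

/-- Modules over a localization `B` of `R` which are injective over `R` are injective over `B`, as
`R`-linear maps between `B`-modules are `B`-linear. -/
theorem Module.Injective.of_isLocalization (S : Submonoid R) [IsLocalization S B]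
    (h : Module.Injective R M) : Module.Injective B M where
  out X Y _ _ _ _ f hf g := by
    let _ := Module.compHom X (algebraMap R B)
    let _ := Module.compHom Y (algebraMap R B)
    have : IsScalarTower R B X := IsScalarTower.of_algebraMap_smul fun _ _ => rfl
    have : IsScalarTower R B Y := IsScalarTower.of_algebraMap_smul fun _ _ => rfl
    obtain ⟨k, hk⟩ := h.out (f.restrictScalars R) hf (g.restrictScalars R)
    exact ⟨k.extendScalarsOfIsLocalization S B, hk⟩

/-- Injective modules over a flat algebra are injective over the base ring. -/
theorem Module.Injective.restrictScalars_of_flat [Module.Flat R B] (h : Module.Injective B M) :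
    Module.Injective R M where
  out X Y _ _ _ _ f hf g := by
    have hinj : Function.Injective (f.baseChange B) :=
      Module.Flat.lTensor_preserves_injective_linearMap f hf
    obtain ⟨k, hk⟩ := h.out (f.baseChange B) hinj (LinearMap.liftBaseChange B g)
    refine ⟨k.restrictScalars R ∘ₗ TensorProduct.mk R B Y 1, fun x => ?_⟩
    simpa using hk (1 ⊗ₜ x)

end ChangeOfRings

/-! ### FP-injective modules and systems of linear equations -/

section FPInjective

variable {R : Type u} [CommRing R]

/-- Every finite system of linear equations over `M` which satisfies the obvious compatibility
conditions has a solution: if each linear relation between the rows of the coefficient matrix `c` is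
also satisfied by the right hand sides `b`, then `∑ j, c i j • y j = b i` is solvable. This is an
elementary form of FP-injectivity. -/
def SolvesCompatibleSystems (R M : Type u) [CommRing R] [AddCommGroup M] [Module R M] : Prop :=
  ∀ (m n : ℕ) (c : Fin m → Fin n → R) (b : Fin m → M),
    (∀ v : Fin m → R, (∀ j, ∑ i, v i * c i j = 0) → ∑ i, v i • b i = 0) →
      ∃ y : Fin n → M, ∀ i, ∑ j, c i j • y j = b i

/-- `Ext¹(F, E)` vanishes if and only if all homomorphisms to `E` from the kernel of a projective
presentation of `F` extend. -/
theorem subsingleton_ext_one_iff {P F E : Type u} [AddCommGroup P] [Module R P] [AddCommGroup F]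
    [Module R F] [AddCommGroup E] [Module R E] [Module.Projective R P] (f : P →ₗ[R] F)
    (hf : Function.Surjective f) :
    Subsingleton (Abelian.Ext (ModuleCat.of R F) (ModuleCat.of R E) 1) ↔
      ∀ h : LinearMap.ker f →ₗ[R] E, ∃ k : P →ₗ[R] E, ∀ x : LinearMap.ker f, k x = h x := by
  have hS := LinearMap.shortExact_shortComplexKer hf
  have : Projective (f.shortComplexKer).X₂ := 
    (IsProjective.iff_projective (R := R) P).1 inferInstance
  constructor
  · intro hsub h
    obtain ⟨x₂, hx₂⟩ := Abelian.Ext.contravariant_sequence_exact₁ hS (ModuleCat.of R E)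
      (Abelian.Ext.mk₀ (ModuleCat.ofHom h)) (add_zero 1) (Subsingleton.elim _ _)
    obtain ⟨k, rfl⟩ := (Abelian.Ext.mk₀_bijective _ _).2 x₂
    rw [Abelian.Ext.mk₀_comp_mk₀] at hx₂
    have hk := (Abelian.Ext.mk₀_bijective _ _).1 hx₂
    exact ⟨k.hom, fun x => LinearMap.congr_fun (congrArg ModuleCat.Hom.hom hk) x⟩
  · intro H
    refine subsingleton_of_forall_eq 0 fun x₃ => ?_
    obtain ⟨x₁, rfl⟩ := Abelian.Ext.contravariant_sequence_exact₃ hS (ModuleCat.of R E) x₃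
      (Abelian.Ext.eq_zero_of_projective _) (add_zero 1)
    obtain ⟨h, rfl⟩ := (Abelian.Ext.mk₀_bijective _ _).2 x₁
    obtain ⟨k, hk⟩ := H h.hom
    have : h = (f.shortComplexKer).f ≫ ModuleCat.ofHom k := by
      ext x
      exact (hk x).symm
    rw [this, ← Abelian.Ext.mk₀_comp_mk₀, ShortComplex.ShortExact.extClass_comp_assoc]

/-- FP-injectivity in elementary terms: a system of linear equations is a homomorphism from the
submodule of `Rⁿ` generated by its rows, and a solution is an extension to `Rⁿ`. -/
theorem isFPInjective_iff {M : Type u} [AddCommGroup M] [Module R M] :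
    IsFPInjective R M ↔ SolvesCompatibleSystems R M := by
  constructor
  · intro H m n c b hb
    let φ : (Fin m → R) →ₗ[R] (Fin n → R) := Fintype.linearCombination R c
    let β : (Fin m → R) →ₗ[R] M := Fintype.linearCombination R b
    have hle : LinearMap.ker φ ≤ LinearMap.ker β := fun v hv => by
      have h1 : φ v = 0 := hv
      refine LinearMap.mem_ker.2 ?_
      rw [Fintype.linearCombination_apply]
      refine hb v fun j => ?_
      simpa [φ, Fintype.linearCombination_apply] using congrFun h1 j
    have hker : LinearMap.ker (LinearMap.range φ).mkQ = LinearMap.range φ := Submodule.ker_mkQ _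
    have : Module.FinitePresentation R ((Fin n → R) ⧸ LinearMap.range φ) :=
      Module.finitePresentation_of_surjective _ (Submodule.mkQ_surjective _) (by
        rw [hker, LinearMap.range_eq_map]; exact Module.Finite.fg_top.map φ)
    have hsub := H _ this
    obtain ⟨k, hk⟩ := (subsingleton_ext_one_iff _ (Submodule.mkQ_surjective (LinearMap.range φ))).1
      hsub ((LinearMap.ker φ).liftQ β hle ∘ₗ φ.quotKerEquivRange.symm.toLinearMap ∘ₗ
        (LinearEquiv.ofEq _ _ hker).toLinearMap)
    refine ⟨fun j => k (Pi.single j 1), fun i => ?_⟩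
    have hi : φ (Pi.single i 1) = c i := by simp [φ, Fintype.linearCombination_apply_single]
    have h1 := hk ⟨φ (Pi.single i 1), by rw [hker]; exact ⟨_, rfl⟩⟩
    have h2 : φ.quotKerEquivRange.symm ⟨φ (Pi.single i 1), ⟨_, rfl⟩⟩ =
        (LinearMap.ker φ).mkQ (Pi.single i 1) := by
      rw [LinearEquiv.symm_apply_eq]; rfl
    have h3 : k (c i) = b i := by
      rw [← hi]
      refine h1.trans ?_
      change (LinearMap.ker φ).liftQ β hle (φ.quotKerEquivRange.symm ⟨φ (Pi.single i 1), _⟩) = _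
      rw [h2]
      simp [β, Fintype.linearCombination_apply_single]
    rw [← h3]
    conv_rhs => rw [← Finset.univ_sum_single (c i)]
    rw [map_sum]
    refine Finset.sum_congr rfl fun j _ => ?_
    rw [← map_smul, ← Pi.single_smul', smul_eq_mul, mul_one]
  · intro H F _ _ hF
    obtain ⟨n, m, f, g, hf, hg⟩ := Module.FinitePresentation.exists_fin' R F
    refine (subsingleton_ext_one_iff f hf).2 fun h => ?_
    have hgf : ∀ v, g v ∈ LinearMap.ker f := fun v => (hg _).2 ⟨v, rfl⟩
    let g' := g.codRestrict (LinearMap.ker f) hgf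
    have hsum : ∀ v : Fin m → R, v = ∑ i, v i • (Pi.single i 1 : Fin m → R) := fun v => by
      conv_lhs => rw [← Finset.univ_sum_single v]
      exact Finset.sum_congr rfl fun j _ => by rw [← Pi.single_smul', smul_eq_mul, mul_one]
    obtain ⟨y, hy⟩ := H m n (fun i => g (Pi.single i 1)) (fun i => h (g' (Pi.single i 1))) (by
      intro v hv
      have hgv : g' v = 0 := by
        refine Subtype.ext (funext fun j => ?_)
        change g v j = 0
        rw [← hv j]
        conv_lhs => rw [hsum v]
        simp
      have : ∑ i, v i • h (g' (Pi.single i 1)) = h (g' v) := by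
        conv_rhs => rw [hsum v]
        simp only [map_sum, map_smul]
      rw [this, hgv, map_zero])
    let k : (Fin n → R) →ₗ[R] M := Fintype.linearCombination R y
    refine ⟨k, ?_⟩
    have hk : k ∘ₗ g = h ∘ₗ g' := by
      refine LinearMap.pi_ext' fun i => LinearMap.ext_ring ?_
      simpa [k, Fintype.linearCombination_apply] using hy i
    rintro ⟨x, hx⟩
    obtain ⟨v, rfl⟩ := (hg x).1 hx
    exact LinearMap.congr_fun hk v

theorem Module.Injective.isFPInjective {M : Type u} [AddCommGroup M] [Module R M]
    (h : Module.Injective R M) : IsFPInjective R M := fun _ _ _ _ =>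
  have := Module.injective_object_of_injective_module (inj := h) R M
  Abelian.Ext.subsingleton_of_injective _ _ 0

theorem SolvesCompatibleSystems.of_linearEquiv {M N : Type u} [AddCommGroup M] [Module R M]
    [AddCommGroup N] [Module R N] (e : M ≃ₗ[R] N) (h : SolvesCompatibleSystems R M) :
    SolvesCompatibleSystems R N := by
  intro m n c b hb
  obtain ⟨y, hy⟩ := h m n c (fun i => e.symm (b i)) fun v hv => by
    simpa using congrArg e.symm (hb v hv)
  exact ⟨fun j => e (y j), fun i => by simpa using congrArg e (hy i)⟩

/-- The single equation `i y = z` is solvable in an FP-injective module if `(0 : i) z = 0`. -/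
theorem IsFPInjective.exists_smul_eq {M : Type u} [AddCommGroup M] [Module R M]
    (h : IsFPInjective R M) {i : R} {z : M} (hz : ∀ a, a * i = 0 → a • z = 0) :
    ∃ w : M, i • w = z := by
  obtain ⟨y, hy⟩ := isFPInjective_iff.1 h 1 1 (fun _ _ => i) (fun _ => z)
    fun v hv => by simpa using hz (v 0) (by simpa using hv 0)
  exact ⟨y 0, by simpa using hy 0⟩

section Localization

variable {B M : Type u} [CommRing B] [Algebra R B] [AddCommGroup M] [Module R M] [Module B M]
  [IsScalarTower R B M]

theorem SolvesCompatibleSystems.of_isLocalization (S : Submonoid R) [IsLocalization S B]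
    (h : SolvesCompatibleSystems R M) : SolvesCompatibleSystems B M := by
  intro m n c b hb
  -- clear denominators in the coefficients
  obtain ⟨s, hs⟩ := IsLocalization.exist_integer_multiples_of_finite S
    (fun p : Fin m × Fin n => c p.1 p.2)
  choose r hr using hs
  have hr' : ∀ i j, algebraMap R B (r (i, j)) = algebraMap R B s * c i j := fun i j => by
    rw [hr, Algebra.smul_def]
  have hunit := IsLocalization.map_units B s
  obtain ⟨y, hy⟩ := h m n (fun i j => r (i, j)) (fun i => (s : R) • b i) (by
    intro v hv
    have := hb (fun i => algebraMap R B (v i)) fun j => by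
      refine hunit.mul_right_eq_zero.1 ?_
      rw [Finset.mul_sum, ← map_zero (algebraMap R B), ← hv j, map_sum]
      refine Finset.sum_congr rfl fun i _ => ?_
      rw [map_mul, hr']; ring
    simp only [smul_comm _ (s : R), ← Finset.smul_sum]
    simp only [algebraMap_smul] at this
    rw [this, smul_zero])
  refine ⟨y, fun i => hunit.smul_left_cancel.1 ?_⟩
  rw [algebraMap_smul _ (s : R) (b i), ← hy i, Finset.smul_sum]
  refine Finset.sum_congr rfl fun j _ => ?_
  rw [smul_smul, ← hr', algebraMap_smul]

/-- Together with `SolvesCompatibleSystems.of_isLocalization`: for a module over a localization,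
FP-injectivity does not depend on the ring over which it is considered. -/
theorem SolvesCompatibleSystems.restrictScalars (S : Submonoid R) [IsLocalization S B]
    (h : SolvesCompatibleSystems B M) : SolvesCompatibleSystems R M := by
  intro m n c b hb
  obtain ⟨y, hy⟩ := h m n (fun i j => algebraMap R B (c i j)) b (by
    intro v hv
    obtain ⟨s, hs⟩ := IsLocalization.exist_integer_multiples_of_finite S v
    choose r hr using hs
    have hr' : ∀ i, algebraMap R B (r i) = algebraMap R B s * v i := fun i => by
      rw [hr, Algebra.smul_def]
    have h1 : ∀ j, ∃ t : S, t * ∑ i, r i * c i j = 0 := fun j => by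
      rw [← IsLocalization.map_eq_zero_iff S B, map_sum]
      simp only [map_mul, hr', mul_assoc]
      rw [← Finset.mul_sum, hv j, mul_zero]
    choose t ht using h1
    have h2 := hb (fun i => (∏ j, (t j : R)) * r i) fun j => by
      simp only [mul_assoc]
      rw [← Finset.mul_sum]
      obtain ⟨d, hd⟩ := Finset.dvd_prod_of_mem (fun j => (t j : R)) (Finset.mem_univ j)
      rw [hd, mul_comm (t j : R), mul_assoc, ht, mul_zero]
    have hunit : IsUnit (algebraMap R B (((∏ j, t j) * s : S) : R)) := IsLocalization.map_units B _
    refine hunit.smul_eq_zero.1 ?_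
    rw [← h2, Finset.smul_sum]
    refine Finset.sum_congr rfl fun i _ => ?_
    rw [smul_smul, ← algebraMap_smul B (_ * r i), map_mul, hr', Submonoid.coe_mul, map_mul,
      Submonoid.coe_finsetProd, mul_assoc])
  exact ⟨y, fun i => by simpa only [algebraMap_smul] using hy i⟩

end Localization

/-- A localization of an FP-injective module `G` is FP-injective if `G` is a submodule of a module
`E` whose localization is FP-injective: `G` is a pure submodule of `E`, and this is preserved by
localization. -/
theorem SolvesCompatibleSystems.localization {G E : Type u} [AddCommGroup G] [Module R G]
    [AddCommGroup E] [Module R E] (S : Submonoid R) (hG : SolvesCompatibleSystems R G)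
    (k : G →ₗ[R] E) (hk : Function.Injective k)
    (hE : SolvesCompatibleSystems R (LocalizedModule S E)) :
    SolvesCompatibleSystems R (LocalizedModule S G) := by
  intro m n c b hb
  let f := LocalizedModule.mkLinearMap S G
  let f' := LocalizedModule.mkLinearMap S E
  let κ : LocalizedModule S G →ₗ[R] LocalizedModule S E := IsLocalizedModule.map S f f' k
  have hκ : ∀ x, κ (f x) = f' (k x) := fun x => IsLocalizedModule.map_apply S f f' k x
  obtain ⟨y, hy⟩ := hE m n c (fun i => κ (b i)) fun v hv => by
    simpa only [map_sum, map_smul, map_zero] using congrArg κ (hb v hv)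
  -- common denominators of the right hand sides and of the solution
  obtain ⟨s, hs⟩ := IsLocalizedModule.exist_integer_multiples_of_finite S f b
  obtain ⟨t, ht⟩ := IsLocalizedModule.exist_integer_multiples_of_finite S f' y
  choose g hg using hs
  choose e he using ht
  have hg' : ∀ i, f (g i) = (s : R) • b i := hg
  have he' : ∀ j, f' (e j) = (t : R) • y j := he
  have h1 : ∀ i, ∃ r ∈ S, r • (∑ j, c i j • (s : R) • e j - (t : R) • k (g i)) = 0 := fun i =>
    IsLocalizedModule.exists_smul_eq_zero S f' (by
      simp only [map_sub, map_sum, map_smul, ← hκ, hg', he', ← hy, sub_eq_zero, Finset.smul_sum]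
      refine Finset.sum_congr rfl fun j _ => ?_
      simp only [smul_smul]; congr 1; ring)
  choose r hrS hr using h1
  have hρS : ∏ i, r i ∈ S := S.prod_mem fun i _ => hrS i
  set ρ := ∏ i, r i
  have h2 : ∀ i, ∑ j, c i j • (ρ * s) • e j = (ρ * t) • k (g i) := fun i => by
    obtain ⟨d, hd⟩ := Finset.dvd_prod_of_mem r (Finset.mem_univ i)
    have h3 : ρ • (∑ j, c i j • (s : R) • e j - (t : R) • k (g i)) = 0 := by
      change (∏ i, r i) • _ = _
      rw [hd, mul_comm, mul_smul, hr, smul_zero]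
    rw [smul_sub, sub_eq_zero, Finset.smul_sum, smul_smul] at h3
    rw [← h3]
    refine Finset.sum_congr rfl fun j _ => ?_
    simp only [smul_smul]; congr 1; ring
  obtain ⟨y', hy'⟩ := hG m n c (fun i => (ρ * t) • g i) (by
    intro v hv
    apply hk
    rw [map_zero, map_sum]
    have : ∀ i, k (v i • (ρ * t) • g i) = ∑ j, (v i * c i j) • (ρ * s) • e j := fun i => by
      rw [map_smul, map_smul, ← h2, Finset.smul_sum]
      exact Finset.sum_congr rfl fun j _ => smul_smul _ _ _
    simp only [this]
    rw [Finset.sum_comm]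
    refine Finset.sum_eq_zero fun j _ => ?_
    rw [← Finset.sum_smul, hv, zero_smul])
  have hmem : ρ * t * s ∈ S := S.mul_mem (S.mul_mem hρS t.2) s.2
  choose z hz using fun j => IsLocalizedModule.exists_smul_eq S f hmem (f (y' j))
  refine ⟨z, fun i => IsLocalizedModule.smul_cancel S f hmem ?_⟩
  rw [mul_smul _ (s : R) (b i), ← hg', ← map_smul, ← hy', map_sum, Finset.smul_sum]
  refine Finset.sum_congr rfl fun j _ => ?_
  rw [smul_comm, hz, map_smul]

end FPInjective

/-! ### Coherent and semicoherent valuation rings -/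

section Coherent

variable {A : Type u} [CommRing A]

theorem exists_forall_dvd (hA : ∀ x y : A, x ∣ y ∨ y ∣ x) (s : Finset A) (hs : s.Nonempty) :
    ∃ a ∈ s, ∀ b ∈ s, a ∣ b := by
  induction hs using Finset.Nonempty.cons_induction with
  | singleton a => exact ⟨a, by simp⟩
  | cons a s ha hs ih =>
    obtain ⟨c, hc, hcs⟩ := ih
    rcases hA a c with h | h
    · exact ⟨a, by simp, fun b hb => by
        rcases Finset.mem_cons.1 hb with rfl | hb
        exacts [dvd_rfl, h.trans (hcs b hb)]⟩
    · exact ⟨c, Finset.mem_cons_of_mem hc, fun b hb => by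
        rcases Finset.mem_cons.1 hb with rfl | hb
        exacts [h, hcs b hb]⟩

theorem Ideal.FG.exists_eq_span_singleton (hA : ∀ x y : A, x ∣ y ∨ y ∣ x) {I : Ideal A}
    (hI : I.FG) : ∃ r, I = Ideal.span {r} := by
  obtain ⟨s, rfl⟩ := hI
  rcases s.eq_empty_or_nonempty with rfl | hs
  · exact ⟨0, by simp⟩
  · obtain ⟨a, ha, has⟩ := exists_forall_dvd hA s hs
    refine ⟨a, le_antisymm (Submodule.span_le.2 fun b hb => ?_)
      (Submodule.span_mono (by simpa using ha))⟩
    exact Ideal.mem_span_singleton.2 (has b hb)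

/-- A valuation ring is coherent if and only if the annihilators of its elements are principal. -/
theorem isCoherentRing_iff (hA : ∀ x y : A, x ∣ y ∨ y ∣ x) :
    IsCoherentRing A ↔ ∀ r : A, ∃ b, r * b = 0 ∧ ∀ x, r * x = 0 → b ∣ x := by
  let l : ∀ r : A, A →ₗ[A] Ideal.span {r} := fun r =>
    (LinearMap.toSpanSingleton A A r).codRestrict _ fun x =>
      Ideal.mem_span_singleton.2 ⟨x, by simp [mul_comm]⟩
  have hl : ∀ r, Function.Surjective (l r) := fun r ⟨y, hy⟩ => by
    obtain ⟨c, rfl⟩ := Ideal.mem_span_singleton.1 hy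
    exact ⟨c, Subtype.ext (by simp [l, mul_comm])⟩
  have hker : ∀ r x, x ∈ LinearMap.ker (l r) ↔ r * x = 0 := fun r x => by
    rw [LinearMap.mem_ker, ← Subtype.coe_inj]
    simp [l, mul_comm]
  constructor
  · intro h r
    have := h (Ideal.span {r}) (Submodule.fg_span_singleton r)
    obtain ⟨b, hb⟩ := Ideal.FG.exists_eq_span_singleton hA
      (Module.FinitePresentation.fg_ker (l r) (hl r))
    refine ⟨b, (hker r b).1 (hb ▸ Ideal.mem_span_singleton_self b), fun x hx => ?_⟩
    exact Ideal.mem_span_singleton.1 (hb ▸ (hker r x).2 hx)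
  · intro h I hI
    obtain ⟨r, rfl⟩ := hI.exists_eq_span_singleton hA
    obtain ⟨b, hb, hb'⟩ := h r
    refine Module.finitePresentation_of_free_of_surjective (l r) (hl r) ?_
    have : LinearMap.ker (l r) = Ideal.span {b} := by
      ext x
      rw [hker, Ideal.mem_span_singleton]
      exact ⟨hb' x, fun ⟨c, hc⟩ => by rw [hc, ← mul_assoc, hb, zero_mul]⟩
    rw [this]
    exact Submodule.fg_span_singleton b

/-- Over a semicoherent valuation ring with total ring of fractions `Q`, every zero divisor
`t` satisfies `(0 : a) ⊆ t Q` for some nonzero `a ∈ (0 : t)`. To see this, take an injective module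
`E` containing the ring, and a homomorphism from `E` to an injective module with kernel `t E`; as an
element of a flat module it is a multiple of such an `a`. -/
theorem IsSemicoherentRing.exists_annihilator_le (hA : ∀ x y : A, x ∣ y ∨ y ∣ x)
    (h : IsSemicoherentRing A) {t : A} (ht : t ∉ nonZeroDivisors A) :
    ∃ a, a ≠ 0 ∧ t * a = 0 ∧ ∀ x, a * x = 0 → ∃ s ∈ nonZeroDivisors A, t ∣ s * x := by
  classical
  obtain ⟨E, _, _, ι, hE, hι⟩ := Module.exists_injective_embedding (R := A) A
  let T : Submodule A E := LinearMap.range (LinearMap.lsmul A E t)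
  obtain ⟨F, _, _, κ, hF, hκ⟩ := Module.exists_injective_embedding (R := A) (E ⧸ T)
  obtain ⟨L, _, _, j, hL, hj⟩ := h E F hE hF
  let f : E →ₗ[A] F := κ ∘ₗ T.mkQ
  -- `(0 : (0 : t)) ⊆ t Q`
  have hker : ∀ x : A, x • f = 0 → ∃ s ∈ nonZeroDivisors A, t ∣ s * x := by
    intro x hx
    have h1 : x • ι 1 ∈ T := by
      have := LinearMap.congr_fun hx (ι 1)
      rw [LinearMap.smul_apply, ← map_smul] at this
      have h2 : T.mkQ (x • ι 1) = 0 := hκ (this.trans (map_zero κ).symm)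
      rwa [← LinearMap.mem_ker, Submodule.ker_mkQ] at h2
    obtain ⟨e, he⟩ := h1
    have he' : t • e = x • ι 1 := he
    have hann : ∀ w, t * w = 0 → x * w = 0 := fun w hw => hι (by
      have h3 : ι (x * w) = w • t • e := by
        rw [he', smul_smul, ← map_smul, smul_eq_mul, mul_one, mul_comm]
      rw [h3, smul_smul, mul_comm, hw, zero_smul, map_zero])
    rcases hA t x with h | ⟨c, rfl⟩
    · exact ⟨1, Submonoid.one_mem _, by rwa [one_mul]⟩
    · by_cases hc : c ∈ nonZeroDivisors A
      · exact ⟨c, hc, by rw [mul_comm]⟩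
      · by_cases h0 : x * c = 0
        · have hx0 := hann 1 (by rw [h0, zero_mul])
          rw [mul_one] at hx0
          exact ⟨1, Submonoid.one_mem _, by rw [hx0, mul_zero]; exact dvd_zero _⟩
        · obtain ⟨w, hw, hw'⟩ := exists_mul_eq_zero_mul_ne_zero hA h0 hc
          exact absurd (hann w hw) hw'
  have hf : f ≠ 0 := fun h0 => by
    obtain ⟨s, hs, c, hc⟩ := hker 1 (by rw [h0, smul_zero])
    rw [mul_one] at hc
    exact ht (mul_mem_nonZeroDivisors.1 (hc ▸ hs)).1
  have htf : t • f = 0 := by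
    ext e
    have h1 : T.mkQ (t • e) = 0 := by
      rw [← LinearMap.mem_ker, Submodule.ker_mkQ]; exact ⟨e, rfl⟩
    rw [LinearMap.smul_apply, ← map_smul, LinearMap.comp_apply, h1, map_zero, LinearMap.zero_apply]
  obtain ⟨k, a, y, hy, ha⟩ := Module.Flat.isTrivialRelation_of_sum_smul_eq_zero (R := A) (ι := Unit)
    (f := fun _ => t) (x := fun _ => j f) (by simp [← map_smul, htf])
  replace hy : j f = ∑ i, a () i • y i := hy ()
  have hk : (Finset.univ.image (a ())).Nonempty := by
    rw [Finset.image_nonempty, Finset.univ_nonempty_iff]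
    by_contra hk
    rw [not_nonempty_iff] at hk
    exact hf (hj (by rw [map_zero, hy, Finset.univ_eq_empty, Finset.sum_empty]))
  obtain ⟨a₀, ha₀, hdvd⟩ := exists_forall_dvd hA _ hk
  obtain ⟨i, -, rfl⟩ := Finset.mem_image.1 ha₀
  choose c hc using fun i' => hdvd (a () i') (Finset.mem_image_of_mem _ (Finset.mem_univ i'))
  have hjf : j f = a () i • ∑ i', c i' • y i' := by
    rw [hy, Finset.smul_sum]
    exact Finset.sum_congr rfl fun i' _ => by rw [smul_smul, ← hc]
  refine ⟨a () i, fun h0 => hf (hj (by rw [hjf, h0, zero_smul, map_zero])), by simpa using ha i,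
    fun x hx => hker x (hj ?_)⟩
  rw [map_smul, hjf, smul_smul, mul_comm, hx, zero_smul, map_zero]

/-- Let `M` be an injective module over a valuation ring on which regular elements act
injectively, and let `Q` be the total ring of fractions. If every nonzero zero divisor `r` has an
annihilator `t` with `(0 : t) ⊆ r Q`, then `M` is flat: the elements of `M` killed by `r` are
multiples of `t`. -/
theorem Module.Injective.flat_of_annihilator (hA : ∀ x y : A, x ∣ y ∨ y ∣ x) {M : Type u}
    [AddCommGroup M] [Module A M] (hM : Module.Injective A M)
    (htf : ∀ p ∈ nonZeroDivisors A, ∀ x : M, p • x = 0 → x = 0)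
    (h : ∀ r : A, r ≠ 0 → r ∉ nonZeroDivisors A → ∃ t, r * t = 0 ∧
      ∀ x, t * x = 0 → ∃ s ∈ nonZeroDivisors A, r ∣ s * x) : Module.Flat A M := by
  rw [Module.Flat.iff_lift_lsmul_comp_subtype_injective]
  intro I hI
  obtain ⟨r, rfl⟩ := hI.exists_eq_span_singleton hA
  let r' : Ideal.span {r} := ⟨r, Ideal.mem_span_singleton_self r⟩
  have hpure : ∀ z : Ideal.span {r} ⊗[A] M, ∃ m, z = r' ⊗ₜ m := by
    intro z
    induction z using TensorProduct.induction_on with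
    | zero => exact ⟨0, by simp⟩
    | tmul x m =>
      obtain ⟨c, hc⟩ := Ideal.mem_span_singleton.1 x.2
      have : x = c • r' := Subtype.ext (by simp [r', hc, mul_comm])
      exact ⟨c • m, by rw [this, TensorProduct.smul_tmul]⟩
    | add x y hx hy =>
      obtain ⟨m, rfl⟩ := hx
      obtain ⟨m', rfl⟩ := hy
      exact ⟨m + m', by rw [TensorProduct.tmul_add]⟩
  rw [injective_iff_map_eq_zero]
  intro z hz
  obtain ⟨m, rfl⟩ := hpure z
  have hrm : r • m = 0 := by simpa [r'] using hz
  by_cases hr0 : r = 0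
  · have : r' = 0 := Subtype.ext hr0
    rw [this, TensorProduct.zero_tmul]
  by_cases hr : r ∈ nonZeroDivisors A
  · rw [htf r hr m hrm, TensorProduct.tmul_zero]
  obtain ⟨t, hrt, ht⟩ := h r hr0 hr
  obtain ⟨w, rfl⟩ := hM.exists_smul_eq (i := t) (z := m) fun x hx => by
    obtain ⟨s, hs, c, hc⟩ := ht x (by rw [mul_comm, hx])
    refine htf s hs _ ?_
    rw [smul_smul, hc, mul_comm, mul_smul, hrm, smul_zero]
  have : t • r' = 0 := Subtype.ext (by simp [r', mul_comm, hrt])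
  rw [← TensorProduct.smul_tmul, this, TensorProduct.zero_tmul]

/-- A valuation ring is semicoherent if annihilators in its total ring of fractions `Q` are
principal: `Hom(E, F)` is torsion-free for injective `E`, so it embeds in an injective `Q`-module,
and these are flat. -/
theorem isSemicoherentRing_of_annihilator (hA : ∀ x y : A, x ∣ y ∨ y ∣ x)
    (h : ∀ r : A, r ≠ 0 → r ∉ nonZeroDivisors A → ∃ t, r * t = 0 ∧
      ∀ x, t * x = 0 → ∃ s ∈ nonZeroDivisors A, r ∣ s * x) : IsSemicoherentRing A := by
  intro E F _ _ _ _ hE _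
  let Q := Localization (nonZeroDivisors A)
  obtain ⟨I, _, _, j, hI, hj⟩ :=
    Module.exists_injective_embedding (R := Q) (LocalizedModule (nonZeroDivisors A) (E →ₗ[A] F))
  let _ := Module.compHom I (algebraMap A Q)
  have : IsScalarTower A Q I := IsScalarTower.of_algebraMap_smul fun _ _ => rfl
  refine ⟨I, inferInstance, inferInstance,
    j.restrictScalars A ∘ₗ LocalizedModule.mkLinearMap (nonZeroDivisors A) (E →ₗ[A] F), ?_, ?_⟩
  · refine (hI.restrictScalars_of_flat (R := A)).flat_of_annihilator hA (fun p hp x hx => ?_) h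
    rw [← algebraMap_smul Q] at hx
    exact (IsLocalization.map_units Q (⟨p, hp⟩ : nonZeroDivisors A)).smul_eq_zero.1 hx
  · refine (injective_iff_map_eq_zero _).2 fun f hf => ?_
    obtain ⟨s, hs, hsf⟩ := IsLocalizedModule.exists_smul_eq_zero (nonZeroDivisors A)
      (LocalizedModule.mkLinearMap (nonZeroDivisors A) (E →ₗ[A] F))
      (hj (hf.trans (map_zero j).symm))
    ext e
    -- `E` is divisible by regular elements
    obtain ⟨e', rfl⟩ := hE.exists_smul_eq (i := s) (z := e) fun a ha => by
      rw [eq_zero_of_mem_nonZeroDivisors_mul hs (x := a) (by rw [mul_comm, ha]), zero_smul]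
    rw [map_smul]
    exact LinearMap.congr_fun hsf e'

/-- If `(0 : i) = a Q` for one pair of nonzero elements, where `Q` is the total ring of fractions
of a valuation ring, then `(0 : r) = t Q` is principal for every nonzero zero divisor `r`, and
`(0 : t) = r Q`. -/
theorem exists_annihilator_dvd (hA : ∀ x y : A, x ∣ y ∨ y ∣ x) {i a : A} (hi : i ≠ 0) (ha : a ≠ 0)
    (hia : i * a = 0) (h : ∀ x, i * x = 0 → ∃ s ∈ nonZeroDivisors A, a ∣ s * x) {r : A} (hr : r ≠ 0)
    (hrz : r ∉ nonZeroDivisors A) :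
    ∃ t, r * t = 0 ∧ ∀ x, t * x = 0 → ∃ s ∈ nonZeroDivisors A, r ∣ s * x := by
  suffices H : ∃ t, r * t = 0 ∧ ∀ x, r * x = 0 → ∃ s ∈ nonZeroDivisors A, t ∣ s * x by
    obtain ⟨t, hrt, ht⟩ := H
    refine ⟨t, hrt, fun x hx => ?_⟩
    rcases hA r x with hrx | ⟨c, rfl⟩
    · exact ⟨1, Submonoid.one_mem _, by rwa [one_mul]⟩
    · by_cases hc : c ∈ nonZeroDivisors A
      · exact ⟨c, hc, by rw [mul_comm]⟩
      · obtain ⟨w, hw, hw'⟩ := exists_mul_eq_zero_mul_ne_zero hA hr hc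
        obtain ⟨s, hs, d, hd⟩ := ht w hw
        exact absurd (eq_zero_of_mem_nonZeroDivisors_mul hs
          (by linear_combination x * hd + d * hx)) hw'
  rcases hA i r with ⟨b, rfl⟩ | ⟨b, rfl⟩
  · rcases hA b a with ⟨d, rfl⟩ | ⟨c, rfl⟩
    · refine ⟨d, by rw [← hia]; ring, fun x hx => ?_⟩
      obtain ⟨s, hs, c, hc⟩ := h (b * x) (by rw [← hx]; ring)
      -- `(0 : b) ⊆ d A` because `b d ≠ 0`
      have hb : b * (s * x - d * c) = 0 := by linear_combination hc
      refine ⟨s, hs, ?_⟩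
      rcases hA d (s * x - d * c) with h' | ⟨e, he⟩
      · exact (dvd_sub_left (dvd_mul_right d c)).1 h'
      · exact absurd (by rw [he]; linear_combination e * hb) ha
    · exact absurd (by linear_combination c * hia) hr
  · refine ⟨b * a, by rw [← hia]; ring, fun x hx => ?_⟩
    obtain ⟨s, hs, c, hc⟩ := h x (by linear_combination b * hx)
    rcases hA b c with ⟨c', rfl⟩ | ⟨e, rfl⟩
    · exact ⟨s, hs, c', by rw [hc]; ring⟩
    · by_cases he : e ∈ nonZeroDivisors A
      · exact ⟨e * s, mul_mem he hs, 1, by linear_combination e * hc⟩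
      · obtain ⟨w, hw, hw'⟩ := exists_mul_eq_zero_mul_ne_zero hA (x := r * c) (c := e)
          (by rwa [mul_assoc]) he
        obtain ⟨s', hs', d, hd⟩ := h w (by rw [← hw]; ring)
        exact absurd (eq_zero_of_mem_nonZeroDivisors_mul hs'
          (by linear_combination r * c * hd - r * d * hc + s * d * hx)) hw'

/-- If `HasDividedAnnihilators` fails for a valuation ring with total ring of fractions `Q`, then
`Q` is larger than the ring, and `(0 : i) = a Q` for some nonzero `i` and `a`. -/
theorem exists_of_not_hasDividedAnnihilators (hA : ∀ x y : A, x ∣ y ∨ y ∣ x)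
    (h : ¬ HasDividedAnnihilators A) : ∃ p ∈ nonZeroDivisors A, ¬ IsUnit p ∧ ∃ i a : A,
      i ≠ 0 ∧ a ≠ 0 ∧ i * a = 0 ∧ ∀ x, i * x = 0 → ∃ s ∈ nonZeroDivisors A, a ∣ s * x := by
  rw [HasDividedAnnihilators, not_or] at h
  push Not at h
  obtain ⟨⟨p, hp, hpu⟩, i, a, hi, ha, hia, H⟩ := h
  refine ⟨p, hp, hpu, i, a, hi, ha, hia, fun x hx => ?_⟩
  rcases hA a x with h | ⟨c, rfl⟩
  · exact ⟨1, Submonoid.one_mem _, by rwa [one_mul]⟩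
  · by_cases hc : c ∈ nonZeroDivisors A
    · exact ⟨c, hc, by rw [mul_comm]⟩
    · exact absurd (mul_comm x c) (H x c hx hc)

theorem isUnit_one_sub_mul [IsLocalRing A] {p : A} (hp : ¬ IsUnit p) (c : A) :
    IsUnit (1 - p * c) :=
  IsLocalRing.isUnit_one_sub_self_of_mem_nonunits _ fun h => hp (isUnit_of_mul_isUnit_left h)

/-- For a valuation ring, `HasDividedAnnihilators` is the condition "coherent or not
semicoherent". -/
theorem hasDividedAnnihilators_iff [IsLocalRing A] (hA : ∀ x y : A, x ∣ y ∨ y ∣ x) :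
    HasDividedAnnihilators A ↔ IsCoherentRing A ∨ ¬ IsSemicoherentRing A := by
  constructor
  · intro hQ
    rw [or_iff_not_imp_right, not_not]
    intro hsemi
    rw [isCoherentRing_iff hA]
    intro r
    by_cases hr : r ∈ nonZeroDivisors A
    · exact ⟨0, mul_zero r, fun x hx => by rw [eq_zero_of_mem_nonZeroDivisors_mul hr hx]⟩
    by_cases hr0 : r = 0
    · exact ⟨1, by rw [hr0, zero_mul], fun x _ => one_dvd x⟩
    obtain ⟨a, ha, hra, h⟩ := hsemi.exists_annihilator_le hA hr
    -- regular elements are units, because `(0 : a)` is generated by `r` up to regular elements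
    have hunit : ∀ p ∈ nonZeroDivisors A, IsUnit p := by
      rcases hQ with hQ | hQ
      · exact hQ
      obtain ⟨r', l, hr', hl, rfl⟩ := hQ a r ha hr0 (by rw [mul_comm, hra])
      obtain ⟨s, hs, b, hb⟩ := h r' hr'
      exfalso
      obtain ⟨c, hc⟩ : s ∣ l * b := by
        rcases hA s (l * b) with h | ⟨c, rfl⟩
        · exact h
        · exact absurd (mul_mem_nonZeroDivisors.1 (mul_mem_nonZeroDivisors.1 hs).1).1 hl
      have hcu : ¬ IsUnit c := fun hcu => hl
        (mul_mem_nonZeroDivisors.1 (hc ▸ mul_mem hs hcu.mem_nonZeroDivisors)).1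
      have h1 : r' * (1 - c * 1) = 0 := eq_zero_of_mem_nonZeroDivisors_mul hs
        (by linear_combination hb + r' * hc)
      rw [(isUnit_one_sub_mul hcu 1).mul_left_eq_zero] at h1
      exact hr0 (by rw [h1, mul_zero])
    refine ⟨a, hra, fun x hx => ?_⟩
    rcases hA a x with h' | ⟨c, rfl⟩
    · exact h'
    by_cases hc : c ∈ nonZeroDivisors A
    · exact (hunit c hc).mul_right_dvd.2 dvd_rfl
    · obtain ⟨w, hw, hw'⟩ := exists_mul_eq_zero_mul_ne_zero hA ha hc
      obtain ⟨s, hs, d, hd⟩ := h w hw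
      exact absurd (eq_zero_of_mem_nonZeroDivisors_mul hs
          (by linear_combination x * hd + d * hx)) hw'
  · intro h
    by_contra hQ
    obtain ⟨p, hp, hpu, i, a, hi, ha, hia, H⟩ := exists_of_not_hasDividedAnnihilators hA hQ
    rcases h with h | h
    · obtain ⟨b, hib, hb⟩ := (isCoherentRing_iff hA).1 h i
      rcases hA p b with ⟨b', rfl⟩ | ⟨c, rfl⟩
      · obtain ⟨d, hd⟩ := hb b' (eq_zero_of_mem_nonZeroDivisors_mul hp (by rw [← hib]; ring))
        have h1 : b' * (1 - p * d) = 0 := by linear_combination hd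
        rw [(isUnit_one_sub_mul hpu d).mul_left_eq_zero] at h1
        obtain ⟨e, he⟩ := hb a hia
        exact ha (by rw [he, h1]; ring)
      · exact hi (eq_zero_of_mem_nonZeroDivisors_mul hp (by linear_combination c * hib))
    · exact h (isSemicoherentRing_of_annihilator hA fun r hr hrz =>
        exists_annihilator_dvd hA hi ha hia H hr hrz)

end Coherent

/-! ### Localizations of injective modules of finite Goldie dimension -/

section Arithmetical

variable {R : Type u} [CommRing R]

theorem exists_module_of_bijective (S : Submonoid R) (B : Type u) [CommRing B] [Algebra R B]
    [IsLocalization S B] {N : Type u} [AddCommGroup N] [Module R N]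
    (h : ∀ s ∈ S, Function.Bijective fun x : N => s • x) :
    ∃ _ : Module B N, IsScalarTower R B N := by
  have : IsLocalizedModule S (LinearMap.id : N →ₗ[R] N) :=
    { map_units := fun s => (Module.End.isUnit_iff _).2 (h s s.2)
      surj := fun y => ⟨(y, 1), by simp⟩
      exists_of_eq := fun h => ⟨1, by simpa using h⟩ }
  exact ⟨IsLocalizedModule.module S LinearMap.id,
    IsLocalizedModule.isScalarTower_module S LinearMap.id⟩

/-- The valuation ring case applied to an injective `R`-module which is an `R_P`-module, that is, on
which the elements outside `P` act bijectively. -/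
theorem injective_localizedModule_of_bijective (P : Ideal R) [P.IsPrime]
    (hA : ∀ x y : Localization.AtPrime P, x ∣ y ∨ y ∣ x)
    (hQ : HasDividedAnnihilators (Localization.AtPrime P)) {N : Type u} [AddCommGroup N]
    [Module R N] (hN : Module.Injective R N) (hbij : ∀ s ∉ P, Function.Bijective fun x : N => s • x)
    (S : Submonoid R) : Module.Injective R (LocalizedModule S N) := by
  let A := Localization.AtPrime P
  obtain ⟨_, _⟩ := exists_module_of_bijective P.primeCompl A hbij
  let S' := Algebra.algebraMapSubmonoid A S
  have h1 : Module.Injective A (LocalizedModule S' N) :=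
    IsLocalizedModule.injective_of_isUniserial hA hQ (hN.of_isLocalization P.primeCompl) S'
      (LocalizedModule.mkLinearMap S' N)
  have : Module.Flat R A := IsLocalization.flat A P.primeCompl
  have h2 : Module.Injective R (LocalizedModule S' N) := h1.restrictScalars_of_flat
  have := IsLocalizedModule.restrictScalars S (LocalizedModule.mkLinearMap S' N)
  exact h2.of_linearEquiv (IsLocalizedModule.linearEquiv S
    ((LocalizedModule.mkLinearMap S' N).restrictScalars R) (LocalizedModule.mkLinearMap S N))

theorem IsInjectiveHull.surjective {M E : Type u} [AddCommGroup M] [Module R M] [AddCommGroup E]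
    [Module R E] {i : M →ₗ[R] E} (h : IsInjectiveHull i) (hM : Module.Injective R M) :
    Function.Surjective i := by
  obtain ⟨ρ, hρ⟩ := hM.out i h.injective LinearMap.id
  have hker := h.essential (LinearMap.ker ρ) (by
    rw [Submodule.eq_bot_iff]
    rintro _ ⟨⟨x, rfl⟩, hx⟩
    have : x = 0 := (hρ x).symm.trans hx
    rw [this, map_zero])
  intro e
  refine ⟨ρ e, LinearMap.ker_eq_bot.1 hker ?_⟩
  exact hρ (ρ e)

/-- Finite Goldie dimension reduces the localization of injective modules over an arithmetical
ring to valuation rings: an injective module of finite Goldie dimension is a finite product of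
indecomposable injective modules, each of which is a module over some `R_P`. -/
theorem Module.Injective.localizedModule (hR : IsArithmeticalRing R)
    (hQ : ∀ (P : Ideal R) [P.IsMaximal], HasDividedAnnihilators (Localization.AtPrime P))
    (S : Submonoid R) {G : Type u} [AddCommGroup G] [Module R G] (hG : Module.Injective R G)
    (hfin : HasFiniteGoldieDimension R G) : Module.Injective R (LocalizedModule S G) := by
  obtain ⟨n, E, _, _, i, hi, N, hN, hNk⟩ := hfin
  have hNS : ∀ k, Module.Injective R (LocalizedModule S (N k)) := fun k => by
    obtain ⟨P, hP, hbij⟩ := (hNk k).2.exists_isMaximal_bijective (hNk k).1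
    exact injective_localizedModule_of_bijective P (hR P).dvd_or_dvd (hQ P) (hNk k).1 hbij S
  let e : G ≃ₗ[R] (∀ k, N k) := LinearEquiv.ofBijective i ⟨hi.injective, hi.surjective hG⟩ ≪≫ₗ
    (LinearEquiv.ofBijective (DirectSum.coeLinearMap N) hN).symm ≪≫ₗ
      DirectSum.linearEquivFunOnFintype R (Fin n) fun k => N k
  let f : G →ₗ[R] ∀ k, LocalizedModule S (N k) :=
    (LinearMap.pi fun k => LocalizedModule.mkLinearMap S (N k) ∘ₗ LinearMap.proj k) ∘ₗ e.toLinearMap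
  have : IsLocalizedModule S f := inferInstance
  exact (Module.Injective.pi R _).of_linearEquiv
    (IsLocalizedModule.linearEquiv S f (LocalizedModule.mkLinearMap S G))

end Arithmetical

/-! ### The injective hull of a residue field -/

section ResidueField

/-- Let `E` be an injective module over a valuation ring `A` which is an essential extension of a
simple submodule generated by `x₀`, and suppose that `(0 : i) = a Q`, where `Q ≠ A` is the total
ring of fractions. Any `e` with `a e = x₀` is killed by `(0 : i)` after localization at the
regular elements, but it is not divisible by `i` there. -/
theorem exists_not_divisible_of_essential {A : Type u} [CommRing A]
    (hA : ∀ x y : A, x ∣ y ∨ y ∣ x) {E : Type u} [AddCommGroup E] [Module A E]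
    (hE : Module.Injective A E) {x₀ : E} (hx₀ : x₀ ≠ 0) (hmax : ∀ c : A, ¬ IsUnit c → c • x₀ = 0)
    (hess : ∀ e : E, e ≠ 0 → ∃ c : A, c • e = x₀) {p : A} (hp : p ∈ nonZeroDivisors A)
    (hpu : ¬ IsUnit p) {i a : A} (hi : i ≠ 0) (ha : a ≠ 0) (hia : i * a = 0)
    (h : ∀ x, i * x = 0 → ∃ s ∈ nonZeroDivisors A, a ∣ s * x) :
    ∃ e : E, (∀ x, i * x = 0 → ∃ s ∈ nonZeroDivisors A, s • x • e = 0) ∧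
      ∀ e' : E, ∀ s ∈ nonZeroDivisors A, ∀ t ∈ nonZeroDivisors A, t • s • e ≠ t • i • e' := by
  obtain ⟨e, he⟩ := hE.exists_smul_eq (i := a) (z := x₀) fun b hb => hmax b fun hbu =>
    ha (hbu.mul_right_eq_zero.1 hb)
  refine ⟨e, fun x hx => ?_, fun e' s hs t ht heq => ?_⟩
  · obtain ⟨s, hs, c, hc⟩ := h x hx
    refine ⟨p * s, mul_mem hp hs, ?_⟩
    rw [smul_smul, show p * s * x = c * p * a by linear_combination p * hc, mul_smul, he, mul_smul,
      hmax p hpu, smul_zero]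
  have hreg : ∀ τ ∈ nonZeroDivisors A, τ • e ≠ 0 := by
    intro τ hτ h0
    rcases hA τ a with ⟨k, rfl⟩ | ⟨k, rfl⟩
    · exact hx₀ (by rw [← he, mul_comm, mul_smul, h0, smul_zero])
    · exact hi (eq_zero_of_mem_nonZeroDivisors_mul hτ (by linear_combination k * hia))
  have he' : e' ≠ 0 := by
    rintro rfl
    exact hreg (t * s) (mul_mem ht hs) (by rw [mul_smul, heq, smul_zero, smul_zero])
  obtain ⟨c, hc⟩ := hess e' he'
  have hpx : ∀ y : A, (y * p) • x₀ = 0 := fun y => by rw [mul_smul, hmax p hpu, smul_zero]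
  rcases hA c i with ⟨d, rfl⟩ | ⟨d, rfl⟩
  · refine hreg (p * (t * s)) (mul_mem hp (mul_mem ht hs)) ?_
    rw [mul_smul, mul_smul, heq, ← hpx (t * d), ← hc]
    simp only [smul_smul]; congr 1; ring
  · have h1 : (p * d * (t * s)) • e = 0 := by
      rw [mul_smul, mul_smul t, heq, ← hpx t, ← hc]
      simp only [smul_smul]; congr 1; ring
    rcases hA a (p * d * (t * s)) with ⟨k, hk⟩ | ⟨k, hk⟩
    · refine hx₀ ?_
      have h2 : i * d = 0 := eq_zero_of_mem_nonZeroDivisors_mul (mul_mem hp (mul_mem ht hs))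
        (by linear_combination i * hk + k * hia)
      rw [← hc, h2, zero_smul]
    · exact hx₀ (by rw [← he, hk, mul_comm, mul_smul, h1, smul_zero])

variable {R : Type u} [CommRing R] {P : Ideal R} {E : Type u} [AddCommGroup E]
  [Module R E] {ι : (R ⧸ P) →ₗ[R] E}

theorem IsInjectiveHull.smul_apply_one_eq_zero_iff (h : IsInjectiveHull ι) {r : R} :
    r • ι 1 = 0 ↔ r ∈ P := by
  rw [← map_smul, map_eq_zero_iff ι h.injective, Algebra.smul_def, mul_one,
    Ideal.Quotient.algebraMap_eq, Ideal.Quotient.eq_zero_iff_mem]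

variable [hP : P.IsMaximal]

theorem Ideal.Quotient.exists_smul_eq_one {x : R ⧸ P} (hx : x ≠ 0) : ∃ r : R, r • x = 1 := by
  let _ := Ideal.Quotient.field P
  obtain ⟨r, hr⟩ := Ideal.Quotient.mk_surjective x⁻¹
  exact ⟨r, by rw [Algebra.smul_def, Ideal.Quotient.algebraMap_eq, hr, inv_mul_cancel₀ hx]⟩

theorem IsInjectiveHull.exists_smul_eq_apply_one (h : IsInjectiveHull ι) {e : E} (he : e ≠ 0) :
    ∃ r : R, r • e = ι 1 := by
  have hne : LinearMap.range ι ⊓ (R ∙ e) ≠ ⊥ := fun h0 =>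
    he (Submodule.span_singleton_eq_bot.1 (h.essential _ h0))
  obtain ⟨_, ⟨⟨q, rfl⟩, hq⟩, hq0⟩ := Submodule.exists_mem_ne_zero_of_ne_bot hne
  obtain ⟨r, hr⟩ := Submodule.mem_span_singleton.1 hq
  obtain ⟨r', hr'⟩ := Ideal.Quotient.exists_smul_eq_one (x := q)
    fun h0 => hq0 (by rw [h0, map_zero])
  exact ⟨r' * r, by rw [mul_smul, hr, ← map_smul, hr']⟩

theorem IsInjectiveHull.apply_one_ne_zero (h : IsInjectiveHull ι) : ι 1 ≠ 0 := fun h0 =>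
  (Ideal.ne_top_iff_one P).1 hP.ne_top (h.smul_apply_one_eq_zero_iff.1 (by rw [h0, smul_zero]))

theorem IsInjectiveHull.bijective_smul (h : IsInjectiveHull ι) {s : R} (hs : s ∉ P) :
    Function.Bijective fun x : E => s • x := by
  have hinj : ∀ x : E, s • x = 0 → x = 0 := by
    intro x hx
    by_contra hx0
    obtain ⟨r, hr⟩ := h.exists_smul_eq_apply_one hx0
    exact hs (h.smul_apply_one_eq_zero_iff.1 (by rw [← hr, smul_comm, hx, smul_zero]))
  refine ⟨fun x y hxy => sub_eq_zero.1 (hinj _ (by rw [smul_sub]; exact sub_eq_zero.2 hxy)),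
    fun y => h.moduleInjective.exists_smul_eq fun a ha => hinj _ ?_⟩
  rw [smul_smul, mul_comm, ha, zero_smul]

theorem IsInjectiveHull.hasFiniteGoldieDimension (h : IsInjectiveHull ι) :
    HasFiniteGoldieDimension R E := by
  have hind : ∀ A B : Submodule R E, IsCompl A B → A = ⊥ ∨ B = ⊥ := by
    intro A B hAB
    by_contra! hne
    have hmem : ∀ X : Submodule R E, X ≠ ⊥ → ι 1 ∈ X := fun X hX => by
      obtain ⟨x, hx, hx0⟩ := Submodule.exists_mem_ne_zero_of_ne_bot hX
      obtain ⟨r, hr⟩ := h.exists_smul_eq_apply_one hx0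
      exact hr ▸ X.smul_mem r hx
    exact h.apply_one_ne_zero
      (Submodule.disjoint_def.1 hAB.disjoint _ (hmem A hne.1) (hmem B hne.2))
  refine ⟨1, E, inferInstance, inferInstance, LinearMap.id,
    ⟨h.moduleInjective, Function.injective_id, fun N hN => by simpa using hN⟩, fun _ => ⊤, ?_,
    fun _ => ⟨h.moduleInjective.of_linearEquiv Submodule.topEquiv.symm, ?_, fun A B hAB => ?_⟩⟩
  · rw [DirectSum.isInternal_submodule_iff_iSupIndep_and_iSup_eq_top]
    exact ⟨iSupIndep_subsingleton _, by simp⟩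
  · exact ⟨⟨⟨ι 1, trivial⟩, 0, fun h0 => h.apply_one_ne_zero (congrArg Subtype.val h0)⟩⟩
  · let φ := Submodule.orderIsoMapComap (Submodule.topEquiv (R := R) (M := E))
    have := hind (φ A) (φ B) ((OrderIso.isCompl_iff φ).1 hAB)
    rwa [map_eq_bot_iff, map_eq_bot_iff] at this

/-- The regular elements of `R_P`, seen in `R`. -/
abbrev regularPreimage (P : Ideal R) [P.IsPrime] : Submonoid R :=
  (nonZeroDivisors (Localization.AtPrime P)).comap (algebraMap R (Localization.AtPrime P))

theorem isLocalization_regularPreimage (P : Ideal R) [P.IsPrime] :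
    IsLocalization (regularPreimage P) (FractionRing (Localization.AtPrime P)) :=
  IsLocalization.localization_localization_isLocalization_of_has_all_units P.primeCompl _ _
    fun _ hx => hx.mem_nonZeroDivisors

/-- If `HasDividedAnnihilators` fails for `R_P`, then the localization of the injective hull of
`R ⧸ P` at the regular elements of `R_P` contains an element violating FP-injectivity. -/
theorem IsInjectiveHull.hasDividedAnnihilators (h : IsInjectiveHull ι)
    (hA : ∀ x y : Localization.AtPrime P, x ∣ y ∨ y ∣ x)
    (hFP : IsFPInjective (FractionRing (Localization.AtPrime P))
      (FractionRing (Localization.AtPrime P) ⊗[R] E)) :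
    HasDividedAnnihilators (Localization.AtPrime P) := by
  by_contra hQ
  let A := Localization.AtPrime P
  let Q := FractionRing A
  let S := regularPreimage P
  obtain ⟨p, hp, hpu, i, a, hi, ha, hia, H⟩ := exists_of_not_hasDividedAnnihilators hA hQ
  obtain ⟨_, _⟩ := exists_module_of_bijective P.primeCompl A
    (fun s hs => h.bijective_smul (s := s) hs)
  have hEA : Module.Injective A E := h.moduleInjective.of_isLocalization P.primeCompl
  obtain ⟨e, he, he'⟩ := exists_not_divisible_of_essential hA hEA h.apply_one_ne_zero
    (fun c hc => by
      obtain ⟨r, s, rfl⟩ := IsLocalization.exists_mk'_eq P.primeCompl c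
      have hr : r ∈ P := by
        by_contra hr
        exact hc ((IsLocalization.AtPrime.isUnit_mk'_iff A P r s).2 hr)
      refine (IsLocalization.map_units A s).smul_eq_zero.1 ?_
      rw [smul_smul, IsLocalization.mk'_spec', algebraMap_smul]
      exact h.smul_apply_one_eq_zero_iff.2 hr)
    (fun e he => by
      obtain ⟨r, hr⟩ := h.exists_smul_eq_apply_one he
      exact ⟨algebraMap R A r, by rw [algebraMap_smul, hr]⟩) hp hpu hi ha hia H
  have : IsLocalization S Q := isLocalization_regularPreimage P
  let f : E →ₗ[R] Q ⊗[R] E := TensorProduct.mk R Q E 1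
  let f' : E →ₗ[A] Q ⊗[R] E := f.extendScalarsOfIsLocalization P.primeCompl A
  have : IsLocalizedModule S (f'.restrictScalars R) :=
    (inferInstance : IsLocalizedModule S (TensorProduct.mk R Q E 1))
  let T := Algebra.algebraMapSubmonoid A S
  have : IsLocalizedModule T f' := IsLocalizedModule.of_restrictScalars S f'
  have hT : T ≤ nonZeroDivisors A := by
    rintro _ ⟨x, hx, rfl⟩
    exact hx
  obtain ⟨w, hw⟩ := hFP.exists_smul_eq (i := algebraMap A Q i) (z := f' e) (by
    intro q hq
    obtain ⟨x, s, rfl⟩ := IsLocalization.exists_mk'_eq (nonZeroDivisors A) q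
    have hx : i * x = 0 := by
      apply IsFractionRing.injective A Q
      rw [map_mul, map_zero, ← IsLocalization.mk'_spec' Q x s, mul_left_comm,
        mul_comm (algebraMap A Q i), hq, mul_zero]
    obtain ⟨t, ht, hte⟩ := he x hx
    refine ((IsLocalization.map_units Q ⟨t, ht⟩).mul
      (IsLocalization.map_units Q s)).smul_eq_zero.1 ?_
    rw [smul_smul, mul_assoc, IsLocalization.mk'_spec', mul_smul, algebraMap_smul, algebraMap_smul,
      ← map_smul, ← map_smul, hte, map_zero])
  rw [algebraMap_smul] at hw
  obtain ⟨s, hs, z, hz⟩ := IsLocalizedModule.exists_smul_eq_apply T f' w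
  obtain ⟨t, ht, htz⟩ := IsLocalizedModule.exists_smul_eq_zero T f' (z := s • e - i • z) (by
    rw [map_sub, map_smul, map_smul, ← hz, ← hw, smul_comm, sub_self])
  rw [smul_sub, sub_eq_zero] at htz
  exact he' z s (hT hs) t (hT ht) htz

end ResidueField

theorem theorem5 (R : Type u) [CommRing R] (hR : IsArithmeticalRing R) :
    List.TFAE [
      ∀ (P : Ideal R) [P.IsMaximal],
        IsCoherentRing (Localization.AtPrime P) ∨ ¬ IsSemicoherentRing (Localization.AtPrime P),
      ∀ (S : Submonoid R) (G : Type u) [AddCommGroup G] [Module R G],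
        Module.Injective R G → HasFiniteGoldieDimension R G →
          Module.Injective (Localization S) (LocalizedModule S G),
      ∀ (S : Submonoid R) (G : Type u) [AddCommGroup G] [Module R G],
        IsFPInjective R G → HasFiniteGoldieDimension R G →
          IsFPInjective (Localization S) (LocalizedModule S G),
      ∀ (P : Ideal R) [P.IsMaximal] (E : Type u) [AddCommGroup E] [Module R E]
        (i : (R ⧸ P) →ₗ[R] E), IsInjectiveHull i →
          IsFPInjective (FractionRing (Localization.AtPrime P))
            (FractionRing (Localization.AtPrime P) ⊗[R] E)] := by
  tfae_have 1 → 2 := by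
    intro h S G _ _ hG hfin
    exact (hG.localizedModule hR (fun P _ =>
      (hasDividedAnnihilators_iff (hR P).dvd_or_dvd).2 (h P)) S hfin).of_isLocalization S
  tfae_have 2 → 3 := by
    intro h S G _ _ hG ⟨n, E, _, _, i, hi, N, hN, hNk⟩
    have hE : HasFiniteGoldieDimension R E := ⟨n, E, inferInstance, inferInstance, LinearMap.id,
      ⟨hi.moduleInjective, Function.injective_id, fun N hN => by simpa using hN⟩, N, hN, hNk⟩
    have hES := isFPInjective_iff.1 (h S E hi.moduleInjective hE).isFPInjective
    exact isFPInjective_iff.2 (((isFPInjective_iff.1 hG).localization S i hi.injective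
      (hES.restrictScalars S)).of_isLocalization S)
  tfae_have 3 → 4 := by
    intro h P _ E _ _ i hi
    have h1 := isFPInjective_iff.1 (h (regularPreimage P) E hi.moduleInjective.isFPInjective
      hi.hasFiniteGoldieDimension)
    have := isLocalization_regularPreimage P
    have e := IsLocalizedModule.linearEquiv (regularPreimage P)
      (LocalizedModule.mkLinearMap (regularPreimage P) E)
      (TensorProduct.mk R (FractionRing (Localization.AtPrime P)) E 1)
    exact isFPInjective_iff.2
      (((h1.restrictScalars (regularPreimage P)).of_linearEquiv e).of_isLocalization
        (regularPreimage P))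
  tfae_have 4 → 1 := by
    intro h P _
    obtain ⟨E, _, _, i, hi⟩ := exists_isInjectiveHull (R := R) (R ⧸ P)
    have hA := (hR P).dvd_or_dvd
    exact (hasDividedAnnihilators_iff hA).1 (hi.hasDividedAnnihilators hA (h P E i hi))
  tfae_finish
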